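/- Let $M$ be a smooth, finite-dimensional (Hausdorff, paracompact) manifold without boundary, $T>0$, $\alpha\in(1/2,1]$, $Z:[0,T]\to\mathbb{R}^d$ an $\alpha$-Hölder continuous path, and let $X(p)\in\mathcal{L}(\mathbb{R}^d,T_pM)$, $p\in M$, be a smooth assignment of $d$ vector fields on $M$. For $s\in[0,T]$ and $p\in M$, a solution of $$dx_t=X(x_t)\,dZ_t$$ starting from $p$ at time $s$ is a continuous path $x:J\to M$ on an interval $J$ with $s\in J\subseteq[s,T]$, such that $x_s=p$ and, for every $f\in C^\infty(M;\mathbb{R})$ and $t\in J$, $$f(x_t)=f(x_s)+\int_s^t Xf(x_r)\,dZ_r,\qquad Xf(q)=Df(q)\circ X(q)\in(\mathbb{R}^d)^*,$$ where the integral is a Young integral: $r\mapsto Xf(x_r)$ is $\beta$-Hölder continuous on $[s,t]$ for some $\beta$ with $\alpha+\beta>1$, and the integral is the limit of Riemann–Stieltjes sums as the mesh tends to $0$. A solution is maximal if it cannot be extended to a solution on a strictly larger interval. (1) For every $x_0\in M$ there is a unique maximal solution $x:J\to M$ starting from $x_0$ at time $0$. Its interval is $J=[0,T]$ or $J=[0,\tau)$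 with $0<\tau\le T$, and every solution starting from $x_0$ at time $0$ is a restriction of it. (2) There is an associated flow of local diffeomorphisms: for $0\le s\le t\le T$ there are sets $D_{s,t}\subseteq M$ and maps $\varphi_{s,t}:D_{s,t}\to M$ such that - for all $s\in[0,T]$ and $p\in M$, the path $t\mapsto\varphi_{s,t}(p)$, defined on $\{t\in[s,T]:p\in D_{s,t}\}$, is a maximal solution starting from $p$ at time $s$; - for each $s$, the set $\{(t,p):p\in D_{s,t}\}$ is relatively open in $[s,T]\times M$, and $(t,p)\mapsto\varphi_{s,t}(p)$ is continuous on it; - each $D_{s,t}$ is open and $\varphi_{s,t}$ is a $C^\infty$ diffeomorphism of $D_{s,t}$ onto an open subset of $M$; - for $0\le s\le t\le u\le T$ and $p\in D_{s,t}$, one has $p\in D_{s,u}$ if and only if $\varphi_{s,t}(p)\in D_{t,u}$, and in that case $\varphi_{s,u}(p)=\varphi_{t,u}(\varphi_{s,t}(p))$. -/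

import Mathlib

open Set Filter Topology
open scoped Manifold ContDiff NNReal

namespace Young

/-- `I` is the Riemann-Stieltjes integral `∫ₐᵇ G dZ`: the limit of the sums
`∑ₖ G(ξₖ) (Z(tₖ₊₁) - Z(tₖ))` over tagged partitions `a = t₀ ≤ ξ₀ ≤ t₁ ≤ ⋯ ≤ t_N = b`,
as the mesh tends to zero. Here `Z` has values in a normed space `V` and `G` in its dual. -/
def HasRSIntegral {V : Type*} [NormedAddCommGroup V] [NormedSpace ℝ V]
    (G : ℝ → V →L[ℝ] ℝ) (Z : ℝ → V) (a b I : ℝ) : Prop :=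
  ∀ ε > (0 : ℝ), ∃ δ > (0 : ℝ), ∀ (N : ℕ) (t ξ : ℕ → ℝ), t 0 = a → t N = b →
    (∀ k < N, t k ≤ ξ k ∧ ξ k ≤ t (k + 1) ∧ t (k + 1) - t k < δ) →
    |∑ k ∈ Finset.range N, G (ξ k) (Z (t (k + 1)) - Z (t k)) - I| < ε

/-- `I` is the integral `∫ₐᵇ G dZ` in the sense of Young: the integrator is `α`-Hölder, the
integrand is `β`-Hölder for some `β` with `α + β > 1`, and `I` is the limit of the
Riemann-Stieltjes sums. -/
def HasYoungIntegral {V : Type*} [NormedAddCommGroup V] [NormedSpace ℝ V]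
    (α : ℝ≥0) (G : ℝ → V →L[ℝ] ℝ) (Z : ℝ → V) (a b I : ℝ) : Prop :=
  (∃ C : ℝ≥0, HolderOnWith C α Z (Icc a b)) ∧
  (∃ β C : ℝ≥0, 1 < α + β ∧ HolderOnWith C β G (Icc a b)) ∧
  HasRSIntegral G Z a b I

section Manifold

variable {n d : ℕ} {M : Type*} [TopologicalSpace M] [ChartedSpace (EuclideanSpace ℝ (Fin n)) M]

/-- The assignment `p ↦ X(p) ∈ L(ℝᵈ, T_pM)` is smooth: every `p ↦ X(p) v` is a smooth vector
field on `M`. -/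
def SmoothFields [IsManifold (𝓡 n) ∞ M]
    (X : ∀ p : M, EuclideanSpace ℝ (Fin d) →L[ℝ] TangentSpace (𝓡 n) p) : Prop :=
  ∀ v : EuclideanSpace ℝ (Fin d), ContMDiff (𝓡 n) (𝓡 n).tangent ∞
    (fun p : M => (⟨p, X p v⟩ : TangentBundle (𝓡 n) M))

/-- `Xf(p) = Df(p) ∘ X(p)`, an element of the dual of `ℝᵈ`; its value at the basis vector `eᵢ` is
the derivative of `f` at `p` along the `i`-th vector field. -/
noncomputable def fieldDeriv
    (X : ∀ p : M, EuclideanSpace ℝ (Fin d) →L[ℝ] TangentSpace (𝓡 n) p) (f : M → ℝ) (p : M) :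
    EuclideanSpace ℝ (Fin d) →L[ℝ] ℝ :=
  (mfderiv (𝓡 n) 𝓘(ℝ, ℝ) f p).comp (X p)

/-- `x : J → M` is a solution of `dxₜ = X(xₜ) dZₜ` on the interval `J ⊆ [s, T]`, with `s ∈ J`,
starting from `p` at time `s`. The values of `x` outside `J` are irrelevant. -/
structure IsSolution (T : ℝ) (α : ℝ≥0)
    (X : ∀ p : M, EuclideanSpace ℝ (Fin d) →L[ℝ] TangentSpace (𝓡 n) p)
    (Z : ℝ → EuclideanSpace ℝ (Fin d)) (s : ℝ) (p : M) (J : Set ℝ) (x : ℝ → M) : Prop where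
  ordConnected : J.OrdConnected
  start_mem : s ∈ J
  subset_Icc : J ⊆ Icc s T
  continuousOn : ContinuousOn x J
  initial : x s = p
  equation : ∀ f : M → ℝ, ContMDiff (𝓡 n) 𝓘(ℝ, ℝ) ∞ f → ∀ t ∈ J,
    HasYoungIntegral α (fun r => fieldDeriv X f (x r)) Z s t (f (x t) - f (x s))

/-- A solution is maximal if it has no extension to a strictly larger interval in `[s, T]`. -/
structure IsMaximalSolution (T : ℝ) (α : ℝ≥0)
    (X : ∀ p : M, EuclideanSpace ℝ (Fin d) →L[ℝ] TangentSpace (𝓡 n) p)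
    (Z : ℝ → EuclideanSpace ℝ (Fin d)) (s : ℝ) (p : M) (J : Set ℝ) (x : ℝ → M) : Prop where
  isSolution : IsSolution T α X Z s p J x
  maximal : ∀ (J' : Set ℝ) (x' : ℝ → M), IsSolution T α X Z s p J' x' →
    J ⊆ J' → EqOn x x' J → J' = J

/-- `φ` maps the set `D` diffeomorphically (in the smooth sense) onto an open set; `D` is open. -/
def IsDiffeoOntoOpen (n : ℕ) {M : Type*} [TopologicalSpace M]
    [ChartedSpace (EuclideanSpace ℝ (Fin n)) M] (φ : M → M) (D : Set M) : Prop :=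
  ∃ e : OpenPartialHomeomorph M M, e.source = D ∧ EqOn e φ D ∧
    ContMDiffOn (𝓡 n) (𝓡 n) ∞ e e.source ∧ ContMDiffOn (𝓡 n) (𝓡 n) ∞ e.symm e.target

/-- `φ s t : D s t → M`, `0 ≤ s ≤ t ≤ T`, is the flow of local diffeomorphisms of the equation
`dxₜ = X(xₜ) dZₜ`: the path `t ↦ φ s t p` is the maximal solution started from `p` at time `s`,
and `D s t` is the set of those `p` whose maximal solution is defined at time `t`. -/
structure IsLocalFlow (T : ℝ) (α : ℝ≥0)
    (X : ∀ p : M, EuclideanSpace ℝ (Fin d) →L[ℝ] TangentSpace (𝓡 n) p)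
    (Z : ℝ → EuclideanSpace ℝ (Fin d)) (D : ℝ → ℝ → Set M) (φ : ℝ → ℝ → M → M) : Prop where
  isMaximalSolution : ∀ s ∈ Icc 0 T, ∀ p : M,
    IsMaximalSolution T α X Z s p {t | p ∈ D s t} (fun t => φ s t p)
  relOpen : ∀ s ∈ Icc 0 T, ∃ U : Set (ℝ × M), IsOpen U ∧
    {q : ℝ × M | q.2 ∈ D s q.1} = U ∩ (Icc s T ×ˢ univ)
  continuousOn : ∀ s ∈ Icc 0 T,
    ContinuousOn (fun q : ℝ × M => φ s q.1 q.2) {q : ℝ × M | q.2 ∈ D s q.1}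
  diffeo : ∀ s t : ℝ, 0 ≤ s → s ≤ t → t ≤ T → IsDiffeoOntoOpen n (φ s t) (D s t)
  cocycle : ∀ s t u : ℝ, 0 ≤ s → s ≤ t → t ≤ u → u ≤ T → ∀ p ∈ D s t,
    (p ∈ D s u ↔ φ s t p ∈ D t u) ∧ (p ∈ D s u → φ s u p = φ t u (φ s t p))

end Manifold

end Young

/-!
A Young equation behaves like an ordinary differential equation once its solutions are described
locally: because `α > 1 / 2`, a continuous path `x` solves `dxₜ = X(xₜ) dZₜ` on a compact interval
if and only if, for every smooth `f`, the increment `f(x_t) - f(x_s)` equals `Xf(x_s)(Z_t - Z_s)` up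
to `O(|t - s| ^ (2α))` (`IsSolution.isPathSolution`, `IsPathSolution.hasYoungIntegral`). That such a
germ determines the increments, and that every germ `G_s (Z_t - Z_s)` has an integral, is the sewing
lemma (`exists_sewing`, `eq_of_norm_sub_le_rpow`). In this form restriction, concatenation, reversal
of time and the chain rule (`HasYoungGerm.comp_contDiff`) are immediate estimates; the last one
makes the equation independent of charts.

Locally, in a chart, the equation is `x = p + ∫ V(x) dZ` in the Banach space of `α`-Hölder paths on
the unit interval (`HolderPath`). The Young integral is a bounded bilinear map there, and `x ↦ V ∘ x`
is smooth (`HolderPath.contDiff_comp`). At the driver `0` and a constant path the derivative of the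
equation in `x` is the identity, so that the inverse function theorem yields, for all small drivers
at once, a solution which is unique near the constant path and depends smoothly on `p`
(`HolderPath.exists_solution_map`). Rescaling time turns a short interval into the unit interval and
makes the driver small, uniformly in the initial time; it also makes any two solutions from the same
point close to a constant path, whence uniqueness (`exists_local_flow`,
`eqOn_short_of_hasYoungGerm`, `IsPathSolution.eqOn`).

Globally, the trajectory of a point up to a time in its interval of existence is compact, hence
covered by finitely many local flows of a uniform duration. Their composition shows that the domain
of the flow is open and that the flow is smooth and jointly continuous
(`flowDomain_mem_nhds_and_contMDiffAt`, `flow_joint`). The inverse of the flow is the flow of the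
time-reversed driver, so it is smooth with open domain for the same reason (`isDiffeoOntoOpen_flow`).
The driver is extended from `[0, T]` to the line by constants, so that `T` plays no role before the
last section.
-/

namespace Young

/-! ### The sewing lemma -/

/-- The constant of the sewing lemma: the solution `K` of `K = 2 ^ (1 - θ) * K + 2`. -/
noncomputable def sewingConst (θ : ℝ) : ℝ := 2 / (1 - 2 ^ (1 - θ))

lemma two_rpow_one_sub_lt_one {θ : ℝ} (hθ : 1 < θ) : (2 : ℝ) ^ (1 - θ) < 1 :=
  Real.rpow_lt_one_of_one_lt_of_neg one_lt_two (by linarith)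

lemma sewingConst_pos {θ : ℝ} (hθ : 1 < θ) : 0 < sewingConst θ :=
  div_pos two_pos (sub_pos.2 (two_rpow_one_sub_lt_one hθ))

lemma sewingConst_eq {θ : ℝ} (hθ : 1 < θ) :
    2 ^ (1 - θ) * sewingConst θ + 2 = sewingConst θ := by
  have := two_rpow_one_sub_lt_one hθ
  have h : (1 - (2 : ℝ) ^ (1 - θ)) ≠ 0 := by linarith
  unfold sewingConst
  field_simp
  ring

section Sewing

variable {F : Type*} [NormedAddCommGroup F] {Ξ : ℝ → ℝ → F} {C θ : ℝ}

lemma sewing_diag (hθ : 1 < θ)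
    (hΞ : ∀ s u t, s ≤ u → u ≤ t → ‖Ξ s t - Ξ s u - Ξ u t‖ ≤ C * (t - s) ^ θ) (s : ℝ) :
    Ξ s s = 0 := by
  have h := hΞ s s s le_rfl le_rfl
  rw [sub_self s, Real.zero_rpow (by linarith), mul_zero] at h
  simpa using norm_le_zero_iff.1 h

/-- Young's maximal inequality. The partition is cut at the interval containing the midpoint, so
that both remaining pieces have at most half the length; as `θ > 1` the bound survives the
induction on the number of intervals. -/
lemma norm_sum_sub_le_of_sewing (hC : 0 ≤ C) (hθ : 1 < θ)
    (hΞ : ∀ s u t, s ≤ u → u ≤ t → ‖Ξ s t - Ξ s u - Ξ u t‖ ≤ C * (t - s) ^ θ) (N : ℕ) :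
    ∀ t : ℕ → ℝ, Monotone t →
      ‖∑ k ∈ Finset.range N, Ξ (t k) (t (k + 1)) - Ξ (t 0) (t N)‖ ≤
        sewingConst θ * C * (t N - t 0) ^ θ := by
  induction N using Nat.strong_induction_on with
  | _ N ih =>
    intro t ht
    have hK := sewingConst_pos hθ
    rcases Nat.eq_zero_or_pos N with rfl | hN
    · simp [sewing_diag hθ hΞ, Real.zero_rpow (by linarith : θ ≠ 0)]
    set L := t N - t 0 with hL
    have hL0 : 0 ≤ L := sub_nonneg.2 (ht (Nat.zero_le N))
    obtain ⟨k, hkN, hk1, hk2⟩ : ∃ k < N, t k ≤ t 0 + L / 2 ∧ t 0 + L / 2 ≤ t (k + 1) := by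
      by_contra! hcon
      have : ∀ k, k ≤ N → t k ≤ t 0 + L / 2 := by
        intro k
        induction k with
        | zero => intro _; linarith
        | succ k ihk => intro hk; exact (hcon k hk (ihk (by omega))).le
      obtain ⟨m, rfl⟩ : ∃ m, N = m + 1 := ⟨N - 1, by omega⟩
      have := hcon m (by omega) (this m (by omega))
      linarith
    obtain ⟨m, rfl⟩ : ∃ m, N = (k + 1) + m := ⟨N - (k + 1), by omega⟩
    have h1 := ih k (by omega) t ht
    have h2 := ih m (by omega) (fun j => t (k + 1 + j)) (fun i j hij => ht (by omega))
    simp only [add_zero] at h2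
    have e1 : (t k - t 0) ^ θ ≤ (L / 2) ^ θ :=
      Real.rpow_le_rpow (sub_nonneg.2 (ht (Nat.zero_le _))) (by linarith) (by linarith)
    have e2 : (t (k + 1 + m) - t (k + 1)) ^ θ ≤ (L / 2) ^ θ :=
      Real.rpow_le_rpow (sub_nonneg.2 (ht (by omega))) (by linarith) (by linarith)
    have e3 : ‖Ξ (t 0) (t (k + 1 + m)) - Ξ (t 0) (t k) - Ξ (t k) (t (k + 1 + m))‖ ≤ C * L ^ θ :=
      hΞ _ _ _ (ht (Nat.zero_le _)) (ht (by omega))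
    have e4 : ‖Ξ (t k) (t (k + 1 + m)) - Ξ (t k) (t (k + 1)) - Ξ (t (k + 1)) (t (k + 1 + m))‖
        ≤ C * L ^ θ := by
      refine (hΞ _ _ _ (ht (by omega)) (ht (by omega))).trans ?_
      have : t 0 ≤ t k := ht (Nat.zero_le _)
      gcongr
      · exact sub_nonneg.2 (ht (by omega))
      · linarith
    have hsplit : ∑ j ∈ Finset.range (k + 1 + m), Ξ (t j) (t (j + 1)) - Ξ (t 0) (t (k + 1 + m)) =
        (∑ j ∈ Finset.range k, Ξ (t j) (t (j + 1)) - Ξ (t 0) (t k)) +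
        (∑ j ∈ Finset.range m, Ξ (t (k + 1 + j)) (t (k + 1 + (j + 1)))
          - Ξ (t (k + 1)) (t (k + 1 + m))) -
        (Ξ (t 0) (t (k + 1 + m)) - Ξ (t 0) (t k) - Ξ (t k) (t (k + 1 + m))) -
        (Ξ (t k) (t (k + 1 + m)) - Ξ (t k) (t (k + 1)) - Ξ (t (k + 1)) (t (k + 1 + m))) := by
      rw [Finset.sum_range_add, Finset.sum_range_succ]
      simp only [add_assoc]
      abel
    have hhalf : 2 * (L / 2) ^ θ = 2 ^ (1 - θ) * L ^ θ := by
      rw [Real.div_rpow hL0 two_pos.le, Real.rpow_sub two_pos, Real.rpow_one]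
      ring
    rw [hsplit]
    refine (norm_sub_le _ _).trans ((add_le_add ((norm_sub_le _ _).trans
      (add_le_add ((norm_add_le _ _).trans (add_le_add h1 h2)) e3)) e4).trans ?_)
    have hKC : 0 ≤ sewingConst θ * C := mul_nonneg hK.le hC
    calc _ ≤ sewingConst θ * C * (L / 2) ^ θ + sewingConst θ * C * (L / 2) ^ θ
          + C * L ^ θ + C * L ^ θ := by gcongr
      _ = (2 ^ (1 - θ) * sewingConst θ + 2) * C * L ^ θ := by linear_combination sewingConst θ * C * hhalf
      _ = sewingConst θ * C * L ^ θ := by rw [sewingConst_eq hθ]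

lemma tendsto_mul_div_rpow (hθ : 1 < θ) (L : ℝ) (hL : 0 ≤ L) :
    Tendsto (fun N : ℕ => ((N : ℝ) + 1) * (L / ((N : ℝ) + 1)) ^ θ) atTop (𝓝 0) := by
  have h1 : Tendsto (fun N : ℕ => ((N : ℝ) + 1)) atTop atTop :=
    tendsto_atTop_add_const_right _ _ tendsto_natCast_atTop_atTop
  have h2 := ((tendsto_rpow_neg_atTop (y := θ - 1) (by linarith)).comp h1).const_mul (L ^ θ)
  rw [mul_zero] at h2
  refine h2.congr fun N => ?_
  have hN : (0 : ℝ) < (N : ℝ) + 1 := by positivity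
  simp only [Function.comp]
  rw [Real.div_rpow hL hN.le, neg_sub, Real.rpow_sub hN, Real.rpow_one]
  ring

/-- The `k`-th point of the uniform partition of `[a, b]` into `N + 1` intervals. -/
noncomputable def uniformPoint (a b : ℝ) (N k : ℕ) : ℝ := a + (b - a) * k / (N + 1)

lemma uniformPoint_mono {a b : ℝ} (hab : a ≤ b) (N : ℕ) : Monotone (uniformPoint a b N) := by
  intro i j hij
  have : 0 ≤ b - a := by linarith
  unfold uniformPoint
  gcongr

lemma uniformPoint_zero (a b : ℝ) (N : ℕ) : uniformPoint a b N 0 = a := by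
  simp [uniformPoint]

lemma uniformPoint_last (a b : ℝ) (N : ℕ) : uniformPoint a b N (N + 1) = b := by
  have : ((N : ℝ) + 1) ≠ 0 := by positivity
  unfold uniformPoint
  push_cast
  field_simp
  ring

lemma uniformPoint_succ_sub (a b : ℝ) (N k : ℕ) :
    uniformPoint a b N (k + 1) - uniformPoint a b N k = (b - a) / (N + 1) := by
  unfold uniformPoint
  push_cast
  ring

/-- Sewing lemma: an almost additive two-parameter function `Ξ` is approximated by the increments
of a path. The path is a limit, along an ultrafilter, of the sums of `Ξ` over uniform partitions;
the use of an ultrafilter and of compactness replaces the comparison of different partitions. -/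
theorem exists_sewing [ProperSpace F] (hC : 0 ≤ C) (hθ : 1 < θ)
    (hΞ : ∀ s u t, s ≤ u → u ≤ t → ‖Ξ s t - Ξ s u - Ξ u t‖ ≤ C * (t - s) ^ θ)
    {a b : ℝ} (hab : a ≤ b) :
    ∃ I : ℝ → F, ∀ s t, a ≤ s → s ≤ t → t ≤ b →
      ‖I t - I s - Ξ s t‖ ≤ sewingConst θ * C * (t - s) ^ θ := by
  have hK := sewingConst_pos hθ
  have hdiag := sewing_diag hθ hΞ
  let p := uniformPoint a b
  let S : ℕ → ℝ → F := fun N t =>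
    ∑ k ∈ Finset.range (N + 1), Ξ (min t (p N k)) (min t (p N (k + 1)))
  have hbound : ∀ t ∈ Icc a b, ∀ N, S N t ∈ Metric.closedBall (Ξ a t)
      (sewingConst θ * C * (t - a) ^ θ) := by
    intro t ht N
    have h := norm_sum_sub_le_of_sewing hC hθ hΞ (N + 1) (fun k => min t (p N k))
      (fun i j hij => min_le_min_left _ (uniformPoint_mono hab N hij))
    simp only [p, uniformPoint_zero, uniformPoint_last, min_eq_right ht.1, min_eq_left ht.2] at h
    rw [mem_closedBall_iff_norm]
    exact h
  have hlim : ∀ t ∈ Icc a b, ∃ l, Tendsto (fun N => S N t) (hyperfilter ℕ) (𝓝 l) := by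
    intro t ht
    obtain ⟨l, -, hl⟩ := (isCompact_closedBall (Ξ a t)
      (sewingConst θ * C * (t - a) ^ θ)).ultrafilter_le_nhds
      (Ultrafilter.map (fun N => S N t) (hyperfilter ℕ))
      (le_principal_iff.2 (Ultrafilter.mem_map.2
        (univ_mem' (f := (hyperfilter ℕ : Filter ℕ)) (hbound t ht))))
    exact ⟨l, hl⟩
  choose! I hI using hlim
  refine ⟨I, fun s t has hst htb => ?_⟩
  -- the sums over the traces of the partition on `[s, t]`
  let R : ℕ → F := fun N => ∑ k ∈ Finset.range (N + 1),
    Ξ (max s (min t (p N k))) (max s (min t (p N (k + 1))))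
  have hR : ∀ N, ‖R N - Ξ s t‖ ≤ sewingConst θ * C * (t - s) ^ θ := by
    intro N
    have h := norm_sum_sub_le_of_sewing hC hθ hΞ (N + 1) (fun k => max s (min t (p N k)))
      (fun i j hij => max_le_max_left _ (min_le_min_left _ (uniformPoint_mono hab N hij)))
    simpa only [p, uniformPoint_zero, uniformPoint_last, min_eq_right (has.trans hst),
      min_eq_left htb, max_eq_left has, max_eq_right hst] using h
  have hdiff : ∀ N : ℕ, ‖S N t - S N s - R N‖ ≤
      C * (((N : ℝ) + 1) * ((b - a) / ((N : ℝ) + 1)) ^ θ) := by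
    intro N
    have hterm : ∀ k, ‖Ξ (min t (p N k)) (min t (p N (k + 1)))
        - Ξ (min s (p N k)) (min s (p N (k + 1)))
        - Ξ (max s (min t (p N k))) (max s (min t (p N (k + 1))))‖
          ≤ C * ((b - a) / (N + 1)) ^ θ := by
      intro k
      have hL : 0 ≤ (b - a) / ((N : ℝ) + 1) :=
        div_nonneg (by linarith) (by positivity)
      have hxy : p N k ≤ p N (k + 1) := uniformPoint_mono hab N (Nat.le_succ k)
      have hyx : p N (k + 1) - p N k = (b - a) / (N + 1) := uniformPoint_succ_sub a b N k
      generalize p N k = x at *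
      generalize p N (k + 1) = y at *
      have hnonneg : 0 ≤ C * ((b - a) / (N + 1)) ^ θ :=
        mul_nonneg hC (Real.rpow_nonneg hL _)
      rcases le_total y s with hys | hys
      · have hxs := hxy.trans hys
        simp [min_eq_right hxs, min_eq_right hys, min_eq_right (hxs.trans hst),
          min_eq_right (hys.trans hst), max_eq_left hxs, max_eq_left hys, hdiag, hnonneg]
      rcases le_total s x with hsx | hsx
      · simp [min_eq_left hsx, min_eq_left hys, hdiag, max_eq_right (le_min hst hsx),
          max_eq_right (le_min hst hys), hnonneg]
      · rw [min_eq_right (hsx.trans hst), min_eq_right hsx, min_eq_left hys, max_eq_left hsx,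
          max_eq_right (le_min hst hys)]
        refine (hΞ _ _ _ hsx (le_min hst hys)).trans ?_
        rw [← hyx]
        gcongr
        · exact sub_nonneg.2 (hsx.trans (le_min hst hys))
        · exact min_le_right _ _
    simp only [S, R]
    rw [← Finset.sum_sub_distrib, ← Finset.sum_sub_distrib]
    refine (norm_sum_le_of_le _ fun k _ => hterm k).trans (le_of_eq ?_)
    rw [Finset.sum_const, Finset.card_range, nsmul_eq_mul]
    push_cast
    ring
  have h1 : Tendsto (fun N => ‖S N t - S N s - Ξ s t‖) (hyperfilter ℕ) (𝓝 ‖I t - I s - Ξ s t‖) :=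
    (((hI t ⟨has.trans hst, htb⟩).sub (hI s ⟨has, hst.trans htb⟩)).sub_const _).norm
  have h2 : Tendsto (fun N : ℕ => C * (((N : ℝ) + 1) * ((b - a) / ((N : ℝ) + 1)) ^ θ)
      + sewingConst θ * C * (t - s) ^ θ) (hyperfilter ℕ)
      (𝓝 (C * 0 + sewingConst θ * C * (t - s) ^ θ)) :=
    (((tendsto_mul_div_rpow hθ _ (by linarith)).mono_left Nat.hyperfilter_le_atTop).const_mul
      C).add_const _
  rw [mul_zero, zero_add] at h2
  refine le_of_tendsto_of_tendsto' h1 h2 fun N => ?_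
  calc ‖S N t - S N s - Ξ s t‖ = ‖(S N t - S N s - R N) + (R N - Ξ s t)‖ := by congr 1; abel
    _ ≤ _ := (norm_add_le _ _).trans (add_le_add (hdiff N) (hR N))

/-- A path whose increments are of order greater than one is constant. -/
lemma eq_of_norm_sub_le_rpow (hθ : 1 < θ) {a b : ℝ} {D : ℝ → F}
    (hD : ∀ s t, a ≤ s → s ≤ t → t ≤ b → ‖D t - D s‖ ≤ C * (t - s) ^ θ) (hab : a ≤ b) :
    D b = D a := by
  have key : ∀ N : ℕ, ‖D b - D a‖ ≤ C * (((N : ℝ) + 1) * ((b - a) / ((N : ℝ) + 1)) ^ θ) := by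
    intro N
    have hm := uniformPoint_mono hab N
    have hsum := Finset.sum_range_sub (fun k => D (uniformPoint a b N k)) (N + 1)
    rw [uniformPoint_zero, uniformPoint_last] at hsum
    rw [← hsum]
    refine (norm_sum_le_of_le _ (f := fun k => D (uniformPoint a b N (k + 1))
      - D (uniformPoint a b N k)) (n := fun _ => C * ((b - a) / (N + 1)) ^ θ)
      fun k hk => ?_).trans (le_of_eq ?_)
    · rw [← uniformPoint_succ_sub a b N k]
      refine hD _ _ ?_ (hm (Nat.le_succ k)) ?_
      · simpa [uniformPoint_zero] using hm (Nat.zero_le k)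
      · simpa [uniformPoint_last] using hm (show k + 1 ≤ N + 1 by
          have := Finset.mem_range.1 hk; omega)
    · rw [Finset.sum_const, Finset.card_range, nsmul_eq_mul]
      push_cast
      ring
  have h2 := (tendsto_mul_div_rpow hθ (b - a) (by linarith)).const_mul C
  rw [mul_zero] at h2
  have := ge_of_tendsto' h2 key
  exact sub_eq_zero.1 (norm_le_zero_iff.1 this)

end Sewing

/-! ### Young integrals -/

section Integral

variable {A F : Type*} [NormedAddCommGroup A] [NormedSpace ℝ A]
  [NormedAddCommGroup F] [NormedSpace ℝ F]

lemma rpow_mul_rpow_le {x y z α β : ℝ} (hx : 0 ≤ x) (hy : 0 ≤ y) (hxz : x ≤ z) (hyz : y ≤ z)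
    (hα : 0 ≤ α) (hβ : 0 ≤ β) (h : 0 < α + β) : x ^ β * y ^ α ≤ z ^ (α + β) := by
  rw [Real.rpow_add' (hx.trans hxz) h.ne', mul_comm]
  have := hx.trans hxz
  gcongr

/-- The almost additivity of `G s (Z t - Z s)`. -/
lemma norm_young_germ_le {G : ℝ → A →L[ℝ] F} {Z : ℝ → A} {α β CG CZ : ℝ} (hα : 0 ≤ α)
    (hβ : 0 ≤ β) (hαβ : 1 < α + β) (hCG : 0 ≤ CG) (hCZ : 0 ≤ CZ)
    (hG : ∀ s t, ‖G t - G s‖ ≤ CG * |t - s| ^ β)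
    (hZ : ∀ s t, ‖Z t - Z s‖ ≤ CZ * |t - s| ^ α) (s u t : ℝ) (hsu : s ≤ u) (hut : u ≤ t) :
    ‖G s (Z t - Z s) - G s (Z u - Z s) - G u (Z t - Z u)‖ ≤ CG * CZ * (t - s) ^ (α + β) := by
  have e : G s (Z t - Z s) - G s (Z u - Z s) - G u (Z t - Z u) = -((G u - G s) (Z t - Z u)) := by
    simp only [map_sub, _root_.sub_apply]
    abel
  rw [e, norm_neg]
  have h1 := hG s u
  have h2 := hZ u t
  rw [abs_of_nonneg (by linarith)] at h1 h2
  calc _ ≤ ‖G u - G s‖ * ‖Z t - Z u‖ := ContinuousLinearMap.le_opNorm _ _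
    _ ≤ (CG * (u - s) ^ β) * (CZ * (t - u) ^ α) := by
        gcongr
    _ = CG * CZ * ((u - s) ^ β * (t - u) ^ α) := by ring
    _ ≤ _ := by
        gcongr
        exact rpow_mul_rpow_le (by linarith) (by linarith) (by linarith) (by linarith) hα hβ
          (by linarith)

/-- Existence of the indefinite Young integral, with Young's estimate. -/
theorem exists_young_integral [ProperSpace F] {G : ℝ → A →L[ℝ] F} {Z : ℝ → A} {α β CG CZ : ℝ}
    (hα : 0 ≤ α) (hβ : 0 ≤ β) (hαβ : 1 < α + β) (hCG : 0 ≤ CG) (hCZ : 0 ≤ CZ)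
    (hG : ∀ s t, ‖G t - G s‖ ≤ CG * |t - s| ^ β)
    (hZ : ∀ s t, ‖Z t - Z s‖ ≤ CZ * |t - s| ^ α) {a b : ℝ} (hab : a ≤ b) :
    ∃ I : ℝ → F, ∀ s t, a ≤ s → s ≤ t → t ≤ b →
      ‖I t - I s - G s (Z t - Z s)‖ ≤ sewingConst (α + β) * (CG * CZ) * (t - s) ^ (α + β) :=
  exists_sewing (mul_nonneg hCG hCZ) hαβ (norm_young_germ_le hα hβ hαβ hCG hCZ hG hZ) hab

/-- A path whose increments are approximated by `G s (Z t - Z s)` to an order greater than one is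
an indefinite Riemann-Stieltjes integral of `G` against `Z`. -/
theorem hasRSIntegral_of_germ {G : ℝ → A →L[ℝ] ℝ} {Z : ℝ → A} {α β θ C CG CZ : ℝ} (hα : 0 ≤ α)
    (hβ : 0 ≤ β) (hαβ : 1 < α + β) (hθ : 1 < θ) (hC : 0 ≤ C) (hCG : 0 ≤ CG) (hCZ : 0 ≤ CZ)
    {a b : ℝ}
    (hG : ∀ s t, a ≤ s → s ≤ t → t ≤ b → ‖G t - G s‖ ≤ CG * (t - s) ^ β)
    (hZ : ∀ s t, a ≤ s → s ≤ t → t ≤ b → ‖Z t - Z s‖ ≤ CZ * (t - s) ^ α) {I : ℝ → ℝ}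
    (hI : ∀ s t, a ≤ s → s ≤ t → t ≤ b → |I t - I s - G s (Z t - Z s)| ≤ C * (t - s) ^ θ) :
    HasRSIntegral G Z a b (I b - I a) := by
  intro ε hε
  have hlim : Tendsto (fun δ : ℝ => (CG * CZ * δ ^ (α + β - 1) + C * δ ^ (θ - 1)) * (b - a))
      (𝓝 0) (𝓝 0) := by
    have h1 : Tendsto (fun δ : ℝ => δ ^ (α + β - 1)) (𝓝 0) (𝓝 ((0 : ℝ) ^ (α + β - 1))) :=
      (Real.continuousAt_rpow_const 0 _ (Or.inr (by linarith)))
    have h2 : Tendsto (fun δ : ℝ => δ ^ (θ - 1)) (𝓝 0) (𝓝 ((0 : ℝ) ^ (θ - 1))) :=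
      (Real.continuousAt_rpow_const 0 _ (Or.inr (by linarith)))
    have := ((h1.const_mul (CG * CZ)).add (h2.const_mul C)).mul_const (b - a)
    rw [Real.zero_rpow (by linarith), Real.zero_rpow (by linarith)] at this
    simpa using this
  obtain ⟨δ, hδε, hδ⟩ : ∃ δ : ℝ, (CG * CZ * δ ^ (α + β - 1) + C * δ ^ (θ - 1)) * (b - a) < ε ∧
      0 < δ := by
    have h1 := (hlim.mono_left (nhdsWithin_le_nhds (s := Ioi 0))).eventually (gt_mem_nhds hε)
    exact (h1.and self_mem_nhdsWithin).exists
  refine ⟨δ, hδ, fun N t ξ h0 hN hpart => ?_⟩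
  have hstep : ∀ k < N, t k ≤ t (k + 1) := fun k hk => (hpart k hk).1.trans (hpart k hk).2.1
  have hge : ∀ k, k ≤ N → a ≤ t k := by
    intro k
    induction k with
    | zero => intro _; exact h0.ge
    | succ k ih => intro hk; exact (ih (by omega)).trans (hstep k hk)
  have hle : ∀ j, ∀ k, k + j = N → t k ≤ b := by
    intro j
    induction j with
    | zero => intro k hk; simp at hk; rw [hk, hN]
    | succ j ih => intro k hk; exact (hstep k (by omega)).trans (ih (k + 1) (by omega))
  have hterm : ∀ k ∈ Finset.range N, ‖G (ξ k) (Z (t (k + 1)) - Z (t k)) - (I (t (k + 1)) - I (t k))‖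
      ≤ (CG * CZ * δ ^ (α + β - 1) + C * δ ^ (θ - 1)) * (t (k + 1) - t k) := by
    intro k hk
    have hk := Finset.mem_range.1 hk
    obtain ⟨h1, h2, h3⟩ := hpart k hk
    have ha := hge k hk.le
    have hb := hle (N - (k + 1)) (k + 1) (by omega)
    have hx : 0 ≤ t (k + 1) - t k := by linarith
    have e1 := hG (t k) (ξ k) ha h1 (h2.trans hb)
    have e2 := hZ (t k) (t (k + 1)) ha (h1.trans h2) hb
    have e3 := hI (t k) (t (k + 1)) ha (h1.trans h2) hb
    have hpow : ∀ γ : ℝ, 1 < γ → (t (k + 1) - t k) ^ γ ≤ δ ^ (γ - 1) * (t (k + 1) - t k) := by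
      intro γ hγ
      rcases hx.eq_or_lt with h | h
      · rw [← h, Real.zero_rpow (by linarith), mul_zero]
      · have : (t (k + 1) - t k) ^ γ = (t (k + 1) - t k) ^ (γ - 1) * (t (k + 1) - t k) := by
          rw [Real.rpow_sub_one h.ne', div_mul_cancel₀ _ h.ne']
        rw [this]
        gcongr
    calc _ = ‖(G (ξ k) - G (t k)) (Z (t (k + 1)) - Z (t k))
          - (I (t (k + 1)) - I (t k) - G (t k) (Z (t (k + 1)) - Z (t k)))‖ := by
            rw [_root_.sub_apply]; congr 1; ring
      _ ≤ ‖G (ξ k) - G (t k)‖ * ‖Z (t (k + 1)) - Z (t k)‖ + C * (t (k + 1) - t k) ^ θ :=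
          (norm_sub_le _ _).trans (add_le_add (ContinuousLinearMap.le_opNorm _ _) e3)
      _ ≤ (CG * (ξ k - t k) ^ β) * (CZ * (t (k + 1) - t k) ^ α) + C * (t (k + 1) - t k) ^ θ := by
          gcongr
      _ = CG * CZ * ((ξ k - t k) ^ β * (t (k + 1) - t k) ^ α) + C * (t (k + 1) - t k) ^ θ := by
          ring
      _ ≤ CG * CZ * (t (k + 1) - t k) ^ (α + β) + C * (t (k + 1) - t k) ^ θ := by
          gcongr
          exact rpow_mul_rpow_le (by linarith) hx (by linarith) le_rfl hα hβ (by linarith)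
      _ ≤ CG * CZ * (δ ^ (α + β - 1) * (t (k + 1) - t k))
            + C * (δ ^ (θ - 1) * (t (k + 1) - t k)) := by
          gcongr
          · exact hpow _ hαβ
          · exact hpow _ hθ
      _ = _ := by ring
  have hsumI := Finset.sum_range_sub (fun k => I (t k)) N
  have hsumt := Finset.sum_range_sub t N
  rw [h0, hN] at hsumI hsumt
  rw [← hsumI, ← Finset.sum_sub_distrib]
  refine lt_of_le_of_lt (norm_sum_le_of_le _ hterm) ?_
  rw [← Finset.mul_sum, hsumt]
  exact hδε

theorem HasRSIntegral.unique {G : ℝ → A →L[ℝ] ℝ} {Z : ℝ → A} {a b I I' : ℝ} (hab : a ≤ b)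
    (h : HasRSIntegral G Z a b I) (h' : HasRSIntegral G Z a b I') : I = I' := by
  by_contra hne
  have hε : 0 < |I - I'| / 2 := half_pos (abs_pos.2 (sub_ne_zero.2 hne))
  obtain ⟨δ, hδ, H⟩ := h _ hε
  obtain ⟨δ', hδ', H'⟩ := h' _ hε
  obtain ⟨N, hN⟩ := exists_nat_gt ((b - a) / min δ δ')
  have hmin : 0 < min δ δ' := lt_min hδ hδ'
  have hlt : (b - a) / (N + 1) < min δ δ' := by
    rw [div_lt_iff₀ hmin] at hN
    rw [div_lt_iff₀ (by positivity)]
    linarith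
  have hpart : ∀ k < N + 1, uniformPoint a b N k ≤ uniformPoint a b N k ∧
      uniformPoint a b N k ≤ uniformPoint a b N (k + 1) ∧
      uniformPoint a b N (k + 1) - uniformPoint a b N k < min δ δ' := fun k _ =>
    ⟨le_rfl, uniformPoint_mono hab N (Nat.le_succ k), by rwa [uniformPoint_succ_sub]⟩
  have e := H (N + 1) (uniformPoint a b N) (uniformPoint a b N) (uniformPoint_zero a b N)
    (uniformPoint_last a b N)
    fun k hk => ⟨(hpart k hk).1, (hpart k hk).2.1, (hpart k hk).2.2.trans_le (min_le_left _ _)⟩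
  have e' := H' (N + 1) (uniformPoint a b N) (uniformPoint a b N) (uniformPoint_zero a b N)
    (uniformPoint_last a b N)
    fun k hk => ⟨(hpart k hk).1, (hpart k hk).2.1, (hpart k hk).2.2.trans_le (min_le_right _ _)⟩
  rw [abs_sub_comm] at e
  have := (abs_sub_le I _ I').trans_lt (add_lt_add e e')
  linarith

lemma abs_clamp_sub_le (a b s t : ℝ) :
    |max a (min b t) - max a (min b s)| ≤ |t - s| := by
  have h1 := abs_max_sub_max_le_max a (min b t) a (min b s)
  have h2 := abs_min_sub_min_le_max b t b s
  rw [sub_self, abs_zero, max_eq_right (abs_nonneg (min b t - min b s))] at h1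
  rw [sub_self, abs_zero, max_eq_right (abs_nonneg (t - s))] at h2
  exact h1.trans h2

/-- Clamping to `[a, b]` extends a Hölder path on `[a, b]` to a Hölder path on the line. -/
lemma norm_clamp_sub_le {E : Type*} [NormedAddCommGroup E] {a b C α : ℝ} (hab : a ≤ b)
    (hC : 0 ≤ C) (hα : 0 ≤ α) {G : ℝ → E}
    (hG : ∀ s t, a ≤ s → s ≤ t → t ≤ b → ‖G t - G s‖ ≤ C * (t - s) ^ α) (s t : ℝ) :
    ‖G (max a (min b t)) - G (max a (min b s))‖ ≤ C * |t - s| ^ α := by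
  wlog hst : s ≤ t generalizing s t
  · rw [norm_sub_rev, abs_sub_comm]
    exact this t s (le_of_not_ge hst)
  have hm : max a (min b s) ≤ max a (min b t) := max_le_max_left _ (min_le_min_left _ hst)
  refine (hG _ _ (le_max_left _ _) hm (max_le hab (min_le_left _ _))).trans ?_
  have hm0 := sub_nonneg.2 hm
  gcongr
  exact (le_abs_self _).trans (abs_clamp_sub_le a b s t)

/-- Young's estimate for a path that is known to consist of Riemann-Stieltjes integrals. -/
theorem exists_germ_bound_of_hasRSIntegral {G : ℝ → A →L[ℝ] ℝ} {Z : ℝ → A} {α β CG CZ : ℝ}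
    (hα : 0 ≤ α) (hβ : 0 ≤ β) (hαβ : 1 < α + β) (hCG : 0 ≤ CG) (hCZ : 0 ≤ CZ) {a b : ℝ}
    (hab : a ≤ b)
    (hG : ∀ s t, a ≤ s → s ≤ t → t ≤ b → ‖G t - G s‖ ≤ CG * (t - s) ^ β)
    (hZ : ∀ s t, a ≤ s → s ≤ t → t ≤ b → ‖Z t - Z s‖ ≤ CZ * (t - s) ^ α) {I : ℝ → ℝ}
    (hI : ∀ t ∈ Icc a b, HasRSIntegral G Z a t (I t - I a)) :
    ∃ C, 0 ≤ C ∧ ∀ s t, a ≤ s → s ≤ t → t ≤ b →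
      |I t - I s - G s (Z t - Z s)| ≤ C * (t - s) ^ (α + β) := by
  have hCnn : 0 ≤ sewingConst (α + β) * (CG * CZ) :=
    mul_nonneg (sewingConst_pos hαβ).le (mul_nonneg hCG hCZ)
  obtain ⟨I', hI'⟩ := exists_young_integral hα hβ hαβ hCG hCZ
    (norm_clamp_sub_le hab hCG hβ hG) (norm_clamp_sub_le hab hCZ hα hZ) hab
  have hcl : ∀ t, a ≤ t → t ≤ b → max a (min b t) = t := fun t h1 h2 => by
    rw [min_eq_right h2, max_eq_right h1]
  have hI'' : ∀ s t, a ≤ s → s ≤ t → t ≤ b → |I' t - I' s - G s (Z t - Z s)| ≤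
      sewingConst (α + β) * (CG * CZ) * (t - s) ^ (α + β) := by
    intro s t h1 h2 h3
    have := hI' s t h1 h2 h3
    rwa [hcl s h1 (h2.trans h3), hcl t (h1.trans h2) h3] at this
  have heq : ∀ t, a ≤ t → t ≤ b → I t - I a = I' t - I' a := fun t h1 h2 =>
    (hI t ⟨h1, h2⟩).unique h1 (hasRSIntegral_of_germ hα hβ hαβ hαβ hCnn hCG hCZ
      (fun s u hs hsu hu => hG s u hs hsu (hu.trans h2))
      (fun s u hs hsu hu => hZ s u hs hsu (hu.trans h2))
      (fun s u hs hsu hu => hI'' s u hs hsu (hu.trans h2)))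
  refine ⟨_, hCnn, fun s t h1 h2 h3 => ?_⟩
  have e1 := heq s h1 (h2.trans h3)
  have e2 := heq t (h1.trans h2) h3
  have : I t - I s = I' t - I' s := by linarith
  rw [this]
  exact hI'' s t h1 h2 h3

/-- A path with increments `G s (Z t - Z s)` up to an error of higher order inherits the Hölder
exponent of `Z`. -/
lemma norm_sub_le_of_germ {G : ℝ → A →L[ℝ] F} {Z : ℝ → A} {J : ℝ → F} {α β a b B C CZ : ℝ}
    (hα : 0 ≤ α) (hβ : 0 ≤ β) (hB : 0 ≤ B) (hC : 0 ≤ C) (hG : ∀ t ∈ Icc a b, ‖G t‖ ≤ B)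
    (hZ : ∀ s t, a ≤ s → s ≤ t → t ≤ b → ‖Z t - Z s‖ ≤ CZ * (t - s) ^ α)
    (H : ∀ s t, a ≤ s → s ≤ t → t ≤ b → ‖J t - J s - G s (Z t - Z s)‖ ≤ C * (t - s) ^ (α + β)) :
    ∃ C, 0 ≤ C ∧ ∀ s t, a ≤ s → s ≤ t → t ≤ b → ‖J t - J s‖ ≤ C * (t - s) ^ α := by
  refine ⟨max (C * (b - a) ^ β + B * CZ) 0, le_max_right _ _, fun s t h1 h2 h3 => ?_⟩
  have hts : 0 ≤ t - s := by linarith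
  have hp : (t - s) ^ (α + β) = (t - s) ^ α * (t - s) ^ β :=
    Real.rpow_add_of_nonneg hts hα hβ
  have hp' : (t - s) ^ β ≤ (b - a) ^ β := Real.rpow_le_rpow hts (by linarith) hβ
  have hp0 : 0 ≤ (t - s) ^ α := Real.rpow_nonneg hts _
  calc ‖J t - J s‖ = ‖(J t - J s - G s (Z t - Z s)) + G s (Z t - Z s)‖ := by
        rw [sub_add_cancel]
    _ ≤ C * (t - s) ^ (α + β) + B * (CZ * (t - s) ^ α) := by
        refine (norm_add_le _ _).trans (add_le_add (H s t h1 h2 h3) ?_)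
        refine (ContinuousLinearMap.le_opNorm _ _).trans ?_
        exact mul_le_mul (hG s ⟨h1, h2.trans h3⟩) (hZ s t h1 h2 h3) (norm_nonneg _) hB
    _ ≤ C * ((t - s) ^ α * (b - a) ^ β) + B * (CZ * (t - s) ^ α) := by rw [hp]; gcongr
    _ = (C * (b - a) ^ β + B * CZ) * (t - s) ^ α := by ring
    _ ≤ _ := by gcongr; exact le_max_left _ _

/-- The path `J` has on `[a, b]` the increments `G s (Z t - Z s)` up to an error of order
`2 * α > 1`; this determines the increments of `J`, and it is a local form of the statement that
`J` is an indefinite Young integral of `G` against `Z`. -/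
def HasYoungGerm (α a b : ℝ) (G : ℝ → A →L[ℝ] F) (Z : ℝ → A) (J : ℝ → F) : Prop :=
  ∃ C, 0 ≤ C ∧ ∀ s t, a ≤ s → s ≤ t → t ≤ b →
    ‖J t - J s - G s (Z t - Z s)‖ ≤ C * (t - s) ^ (2 * α)

namespace HasYoungGerm

variable {α a b : ℝ} {G G' : ℝ → A →L[ℝ] F} {Z Z' : ℝ → A} {J J' : ℝ → F}

lemma mono {a' b' : ℝ} (h : HasYoungGerm α a b G Z J) (ha : a ≤ a') (hb : b' ≤ b) :
    HasYoungGerm α a' b' G Z J := by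
  obtain ⟨C, hC, H⟩ := h
  exact ⟨C, hC, fun s t h1 h2 h3 => H s t (ha.trans h1) h2 (h3.trans hb)⟩

lemma congr (h : HasYoungGerm α a b G Z J) (hG : EqOn G' G (Icc a b)) (hZ : EqOn Z' Z (Icc a b))
    (hJ : EqOn J' J (Icc a b)) : HasYoungGerm α a b G' Z' J' := by
  obtain ⟨C, hC, H⟩ := h
  refine ⟨C, hC, fun s t h1 h2 h3 => ?_⟩
  have hs : s ∈ Icc a b := ⟨h1, h2.trans h3⟩
  have ht : t ∈ Icc a b := ⟨h1.trans h2, h3⟩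
  rw [hG hs, hZ hs, hZ ht, hJ hs, hJ ht]
  exact H s t h1 h2 h3

lemma unique (hα : 1 / 2 < α) (hab : a ≤ b) (h : HasYoungGerm α a b G Z J)
    (h' : HasYoungGerm α a b G Z J') : J b - J a = J' b - J' a := by
  obtain ⟨C, hC, H⟩ := h
  obtain ⟨C', hC', H'⟩ := h'
  have := eq_of_norm_sub_le_rpow (θ := 2 * α) (C := C + C') (D := fun t => J t - J' t)
    (by linarith) (a := a) (b := b) (fun s t h1 h2 h3 => by
      have e : J t - J' t - (J s - J' s) = (J t - J s - G s (Z t - Z s))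
        - (J' t - J' s - G s (Z t - Z s)) := by abel
      rw [e, add_mul]
      exact (norm_sub_le _ _).trans (add_le_add (H s t h1 h2 h3) (H' s t h1 h2 h3))) hab
  have h3 : J b - J a - (J' b - J' a) = (J b - J' b) - (J a - J' a) := by abel
  rw [← sub_eq_zero, h3, this, sub_self]

lemma norm_sub_le {B CZ : ℝ} (h : HasYoungGerm α a b G Z J) (hα : 0 ≤ α) (hB : 0 ≤ B)
    (hG : ∀ t ∈ Icc a b, ‖G t‖ ≤ B)
    (hZ : ∀ s t, a ≤ s → s ≤ t → t ≤ b → ‖Z t - Z s‖ ≤ CZ * (t - s) ^ α) :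
    ∃ C, 0 ≤ C ∧ ∀ s t, a ≤ s → s ≤ t → t ≤ b → ‖J t - J s‖ ≤ C * (t - s) ^ α := by
  obtain ⟨C, hC, H⟩ := h
  rw [two_mul] at H
  exact norm_sub_le_of_germ hα hα hB hC hG hZ H

lemma add (h : HasYoungGerm α a b G Z J) (h' : HasYoungGerm α a b G' Z' J')
    {G₁ : ℝ → A →L[ℝ] F} {Z₁ : ℝ → A}
    (hG : ∀ s t, G₁ s (Z₁ t - Z₁ s) = G s (Z t - Z s) + G' s (Z' t - Z' s)) :
    HasYoungGerm α a b G₁ Z₁ (fun t => J t + J' t) := by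
  obtain ⟨C, hC, H⟩ := h
  obtain ⟨C', hC', H'⟩ := h'
  refine ⟨C + C', add_nonneg hC hC', fun s t h1 h2 h3 => ?_⟩
  have e : J t + J' t - (J s + J' s) - G₁ s (Z₁ t - Z₁ s) =
      (J t - J s - G s (Z t - Z s)) + (J' t - J' s - G' s (Z' t - Z' s)) := by
    rw [hG]; abel
  rw [e, add_mul]
  exact (norm_add_le _ _).trans (add_le_add (H s t h1 h2 h3) (H' s t h1 h2 h3))

lemma smul (c : ℝ) (h : HasYoungGerm α a b G Z J) {G₁ : ℝ → A →L[ℝ] F} {Z₁ : ℝ → A}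
    (hG : ∀ s t, G₁ s (Z₁ t - Z₁ s) = c • G s (Z t - Z s)) :
    HasYoungGerm α a b G₁ Z₁ (fun t => c • J t) := by
  obtain ⟨C, hC, H⟩ := h
  refine ⟨|c| * C, mul_nonneg (abs_nonneg c) hC, fun s t h1 h2 h3 => ?_⟩
  rw [hG, ← smul_sub, ← smul_sub, norm_smul, Real.norm_eq_abs, mul_assoc]
  exact mul_le_mul_of_nonneg_left (H s t h1 h2 h3) (abs_nonneg c)

lemma comp_affine {a' b' m c : ℝ} (h : HasYoungGerm α a' b' G Z J) (hm : 0 ≤ m)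
    (ha : a' ≤ m * a + c) (hb : m * b + c ≤ b') :
    HasYoungGerm α a b (fun t => G (m * t + c)) (fun t => Z (m * t + c))
      (fun t => J (m * t + c)) := by
  obtain ⟨C, hC, H⟩ := h
  refine ⟨C * m ^ (2 * α), mul_nonneg hC (Real.rpow_nonneg hm _), fun s t h1 h2 h3 => ?_⟩
  refine (H _ _ (ha.trans (by gcongr)) (by gcongr) (le_trans (by gcongr) hb)).trans (le_of_eq ?_)
  rw [mul_assoc, ← Real.mul_rpow hm (by linarith)]
  congr 2
  ring

end HasYoungGerm

end Integral

/-! ### The Banach space of Hölder paths -/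

/-- The bounded `α`-Hölder paths `x : ℝ → E`, encoded as the pairs of the bounded function `x` and
the bounded function of its Hölder quotients `(s, t) ↦ |t - s| ^ (-α) • (x t - x s)`: a closed
subspace of a product of two `ℓ^∞` spaces, which thereby carries the Hölder norm. -/
def holderSubmodule (α : ℝ) (E : Type*) [NormedAddCommGroup E] [NormedSpace ℝ E] :
    Submodule ℝ (lp (fun _ : ℝ => E) ⊤ × lp (fun _ : ℝ × ℝ => E) ⊤) where
  carrier := {w | ∀ s t : ℝ, w.2 (s, t) = (|t - s| ^ α)⁻¹ • (w.1 t - w.1 s)}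
  add_mem' {v w} hv hw s t := by
    simp only [mem_ofPred_eq] at hv hw
    simp only [Prod.fst_add, Prod.snd_add, lp.coeFn_add, Pi.add_apply, hv, hw, ← smul_add]
    congr 1
    abel
  zero_mem' s t := by simp
  smul_mem' c w hw s t := by
    simp only [mem_ofPred_eq] at hw
    simp only [Prod.smul_fst, Prod.smul_snd, lp.coeFn_smul, Pi.smul_apply, hw, ← smul_sub,
      smul_comm c]

/-- The Banach space of bounded `α`-Hölder paths `ℝ → E`. -/
def HolderPath (α : ℝ) (E : Type*) [NormedAddCommGroup E] [NormedSpace ℝ E] : Type _ :=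
  holderSubmodule α E

namespace HolderPath

variable {α : ℝ} {E : Type*} [NormedAddCommGroup E] [NormedSpace ℝ E]

noncomputable instance : NormedAddCommGroup (HolderPath α E) :=
  inferInstanceAs (NormedAddCommGroup (holderSubmodule α E))

noncomputable instance : NormedSpace ℝ (HolderPath α E) :=
  inferInstanceAs (NormedSpace ℝ (holderSubmodule α E))

/-- The path underlying an element of the Hölder space. -/
def path (x : HolderPath α E) (t : ℝ) : E := x.1.1 t

instance : CoeFun (HolderPath α E) (fun _ => ℝ → E) := ⟨path⟩

lemma isClosed_holderSubmodule : IsClosed (holderSubmodule α E : Set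
    (lp (fun _ : ℝ => E) ⊤ × lp (fun _ : ℝ × ℝ => E) ⊤)) := by
  have hc : ∀ {ι : Type} (i : ι), Continuous fun w : lp (fun _ : ι => E) ⊤ => w i := by
    intro ι i
    refine LipschitzWith.continuous (K := 1) (LipschitzWith.of_dist_le_mul fun v w => ?_)
    rw [NNReal.coe_one, one_mul, dist_eq_norm, dist_eq_norm]
    exact lp.norm_apply_le_norm ENNReal.top_ne_zero (v - w) i
  have : (holderSubmodule α E : Set (lp (fun _ : ℝ => E) ⊤ × lp (fun _ : ℝ × ℝ => E) ⊤)) =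
      ⋂ s : ℝ, ⋂ t : ℝ, {w | w.2 (s, t) = (|t - s| ^ α)⁻¹ • (w.1 t - w.1 s)} := by
    ext w
    simp only [mem_iInter]
    rfl
  rw [this]
  refine isClosed_iInter fun s => isClosed_iInter fun t => isClosed_eq ?_ ?_
  · exact (hc _).comp continuous_snd
  · exact (((hc _).comp continuous_fst).sub ((hc _).comp continuous_fst)).const_smul _

instance [CompleteSpace E] : CompleteSpace (HolderPath α E) :=
  isClosed_holderSubmodule.completeSpace_coe

lemma quotient_apply (x : HolderPath α E) (s t : ℝ) :
    x.1.2 (s, t) = (|t - s| ^ α)⁻¹ • (x t - x s) := x.2 s t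

lemma ext {x y : HolderPath α E} (h : ∀ t, x t = y t) : x = y := by
  refine Subtype.ext (Prod.ext (lp.ext (funext h)) (lp.ext (funext fun ⟨s, t⟩ => ?_)))
  rw [quotient_apply, quotient_apply, h, h]

@[simp] lemma add_apply (x y : HolderPath α E) (t : ℝ) : (x + y) t = x t + y t := rfl
@[simp] lemma sub_apply (x y : HolderPath α E) (t : ℝ) : (x - y) t = x t - y t := rfl
@[simp] lemma smul_apply (c : ℝ) (x : HolderPath α E) (t : ℝ) : (c • x) t = c • x t := rfl
@[simp] lemma zero_apply (t : ℝ) : (0 : HolderPath α E) t = 0 := rfl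

lemma norm_apply_le (x : HolderPath α E) (t : ℝ) : ‖x t‖ ≤ ‖x‖ :=
  (lp.norm_apply_le_norm ENNReal.top_ne_zero x.1.1 t).trans (norm_fst_le x.1)

lemma norm_sub_le (hα : 0 < α) (x : HolderPath α E) (s t : ℝ) :
    ‖x t - x s‖ ≤ ‖x‖ * |t - s| ^ α := by
  rcases eq_or_ne s t with rfl | hst
  · simp [Real.zero_rpow hα.ne']
  have hpos : 0 < |t - s| ^ α := Real.rpow_pos_of_pos (abs_pos.2 (sub_ne_zero.2 hst.symm)) _
  have h : ‖x.1.2 (s, t)‖ ≤ ‖x‖ :=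
    (lp.norm_apply_le_norm ENNReal.top_ne_zero x.1.2 (s, t)).trans (norm_snd_le x.1)
  rw [quotient_apply, norm_smul, norm_inv, Real.norm_of_nonneg hpos.le,
    inv_mul_le_iff₀ hpos] at h
  rwa [mul_comm]

lemma norm_quotient_le {K : ℝ} (hK : 0 ≤ K) {f : ℝ → E}
    (h : ∀ s t, ‖f t - f s‖ ≤ K * |t - s| ^ α) (s t : ℝ) :
    ‖(|t - s| ^ α)⁻¹ • (f t - f s)‖ ≤ K := by
  rcases (Real.rpow_nonneg (abs_nonneg (t - s)) α).eq_or_lt with h0 | hpos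
  · rw [← h0]; simpa using hK
  · rw [norm_smul, norm_inv, Real.norm_of_nonneg hpos.le, inv_mul_le_iff₀ hpos, mul_comm]
    exact h s t

lemma norm_le {K : ℝ} (hK : 0 ≤ K) {x : HolderPath α E} (h1 : ∀ t, ‖x t‖ ≤ K)
    (h2 : ∀ s t, ‖x t - x s‖ ≤ K * |t - s| ^ α) : ‖x‖ ≤ K := by
  refine (norm_prod_le_iff (x := x.1)).2 ⟨lp.norm_le_of_forall_le hK h1,
    lp.norm_le_of_forall_le hK fun ⟨s, t⟩ => ?_⟩
  rw [quotient_apply]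
  exact norm_quotient_le hK h2 s t

lemma exists_of_bound {K : ℝ} (hK : 0 ≤ K) {f : ℝ → E} (h1 : ∀ t, ‖f t‖ ≤ K)
    (h2 : ∀ s t, ‖f t - f s‖ ≤ K * |t - s| ^ α) :
    ∃ x : HolderPath α E, (∀ t, x t = f t) ∧ ‖x‖ ≤ K := by
  let x : HolderPath α E := ⟨(⟨f, memℓp_infty ⟨K, by rintro _ ⟨t, rfl⟩; exact h1 t⟩⟩,
    ⟨fun q => (|q.2 - q.1| ^ α)⁻¹ • (f q.2 - f q.1), memℓp_infty ⟨K, by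
      rintro _ ⟨q, rfl⟩; exact norm_quotient_le hK h2 q.1 q.2⟩⟩), fun s t => rfl⟩
  exact ⟨x, fun t => rfl, norm_le hK h1 h2⟩

/-- Evaluation of Hölder paths at a time. -/
noncomputable def eval (α : ℝ) (E : Type*) [NormedAddCommGroup E] [NormedSpace ℝ E] (t : ℝ) :
    HolderPath α E →L[ℝ] E :=
  LinearMap.mkContinuous
    { toFun := fun x => x t
      map_add' := fun _ _ => rfl
      map_smul' := fun _ _ => rfl } 1 fun x => by rw [one_mul]; exact norm_apply_le x t

@[simp] lemma eval_apply (t : ℝ) (x : HolderPath α E) : eval α E t x = x t := rfl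

lemma exists_const (α : ℝ) (p : E) : ∃ x : HolderPath α E, (∀ t, x t = p) ∧ ‖x‖ ≤ ‖p‖ :=
  exists_of_bound (norm_nonneg p) (fun _ => le_rfl) fun s t => by
    rw [sub_self, norm_zero]; positivity

/-- Constant paths. -/
noncomputable def const (α : ℝ) (E : Type*) [NormedAddCommGroup E] [NormedSpace ℝ E] :
    E →L[ℝ] HolderPath α E :=
  LinearMap.mkContinuous
    { toFun := fun p => (exists_const α p).choose
      map_add' := fun p q => ext fun t => by
        rw [add_apply, (exists_const α _).choose_spec.1, (exists_const α _).choose_spec.1,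
          (exists_const α _).choose_spec.1]
      map_smul' := fun c p => ext fun t => by
        rw [RingHom.id_apply, smul_apply, (exists_const α _).choose_spec.1,
          (exists_const α _).choose_spec.1] } 1
    fun p => by simpa using (exists_const α p).choose_spec.2

@[simp] lemma const_apply (p : E) (t : ℝ) : const α E p t = p :=
  (exists_const α p).choose_spec.1 t

variable {F : Type*} [NormedAddCommGroup F] [NormedSpace ℝ F]

lemma exists_apply (hα : 0 < α) (G : HolderPath α (E →L[ℝ] F)) (h : HolderPath α E) :
    ∃ y : HolderPath α F, (∀ t, y t = G t (h t)) ∧ ‖y‖ ≤ 2 * ‖G‖ * ‖h‖ := by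
  have h1 : ∀ t, ‖G t (h t)‖ ≤ ‖G‖ * ‖h‖ := fun t =>
    ((G t).le_opNorm _).trans (by gcongr <;> apply norm_apply_le)
  refine exists_of_bound (by positivity) (fun t => (h1 t).trans ?_) fun s t => ?_
  · nlinarith [norm_nonneg G, norm_nonneg h, mul_nonneg (norm_nonneg G) (norm_nonneg h)]
  · have e : G t (h t) - G s (h s) = (G t - G s) (h t) + G s (h t - h s) := by
      rw [_root_.sub_apply, map_sub]; abel
    rw [e]
    calc _ ≤ ‖G t - G s‖ * ‖h t‖ + ‖G s‖ * ‖h t - h s‖ :=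
          (norm_add_le _ _).trans (add_le_add ((G t - G s).le_opNorm _) ((G s).le_opNorm _))
      _ ≤ (‖G‖ * |t - s| ^ α) * ‖h‖ + ‖G‖ * (‖h‖ * |t - s| ^ α) := by
          gcongr
          · exact norm_sub_le hα G s t
          · exact norm_apply_le h t
          · exact norm_apply_le G s
          · exact norm_sub_le hα h s t
      _ = _ := by ring

/-- The pointwise application of a path of linear maps to a path of vectors. -/
noncomputable def pointwise (hα : 0 < α) :
    HolderPath α (E →L[ℝ] F) →L[ℝ] HolderPath α E →L[ℝ] HolderPath α F :=
  LinearMap.mkContinuous₂ (LinearMap.mk₂ ℝ (fun G h => (exists_apply hα G h).choose)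
    (fun G G' h => ext fun t => by
      rw [add_apply, (exists_apply hα G h).choose_spec.1, (exists_apply hα G' h).choose_spec.1,
        (exists_apply hα (G + G') h).choose_spec.1, add_apply, _root_.add_apply])
    (fun c G h => ext fun t => by
      rw [smul_apply, (exists_apply hα G h).choose_spec.1,
        (exists_apply hα (c • G) h).choose_spec.1, smul_apply, _root_.smul_apply])
    (fun G h h' => ext fun t => by
      rw [add_apply, (exists_apply hα G h).choose_spec.1, (exists_apply hα G h').choose_spec.1,
        (exists_apply hα G (h + h')).choose_spec.1, add_apply, map_add])
    (fun c G h => ext fun t => by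
      rw [smul_apply, (exists_apply hα G h).choose_spec.1,
        (exists_apply hα G (c • h)).choose_spec.1, smul_apply, map_smul]))
    2 fun G h => (exists_apply hα G h).choose_spec.2

@[simp] lemma pointwise_apply (hα : 0 < α) (G : HolderPath α (E →L[ℝ] F)) (h : HolderPath α E)
    (t : ℝ) : pointwise hα G h t = G t (h t) := (exists_apply hα G h).choose_spec.1 t

/-! ### The Young integral as a bilinear map -/

/-- `J` is the indefinite integral of `G` against `Z` on `[0, 1]`, extended by constants. -/
def IsIntegral (G : HolderPath α (E →L[ℝ] F)) (Z : HolderPath α E) (J : HolderPath α F) : Prop :=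
  J 0 = 0 ∧ HasYoungGerm α 0 1 G Z J ∧ ∀ t, J t = J (max 0 (min 1 t))

lemma exists_integral [ProperSpace F] (hα : 1 / 2 < α) (G : HolderPath α (E →L[ℝ] F))
    (Z : HolderPath α E) :
    ∃ J : HolderPath α F, IsIntegral G Z J ∧ ‖J‖ ≤ (1 + sewingConst (2 * α)) * ‖G‖ * ‖Z‖ := by
  have hα0 : 0 < α := by linarith
  have hK := sewingConst_pos (θ := 2 * α) (by linarith)
  obtain ⟨I, hI⟩ := exists_young_integral (F := F) hα0.le hα0.le (by linarith) (norm_nonneg G)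
    (norm_nonneg Z) (norm_sub_le hα0 G) (norm_sub_le hα0 Z) zero_le_one
  rw [← two_mul] at hI
  let c : ℝ → ℝ := fun t => max 0 (min 1 t)
  have hc : ∀ t, 0 ≤ c t ∧ c t ≤ 1 := fun t => ⟨le_max_left _ _, max_le zero_le_one (min_le_left _ _)⟩
  have hcc : ∀ t, 0 ≤ t → t ≤ 1 → c t = t := fun t h0 h1 => by
    simp only [c]; rw [min_eq_right h1, max_eq_right h0]
  have hinc : ∀ s t, 0 ≤ s → s ≤ t → t ≤ 1 →
      ‖I t - I s‖ ≤ (1 + sewingConst (2 * α)) * ‖G‖ * ‖Z‖ * (t - s) ^ α := by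
    intro s t h0 hst h1
    have hts : 0 ≤ t - s := by linarith
    have hp : (t - s) ^ (2 * α) ≤ (t - s) ^ α := by
      rcases hts.eq_or_lt with h | h
      · rw [← h, Real.zero_rpow (by linarith), Real.zero_rpow hα0.ne']
      · exact Real.rpow_le_rpow_of_exponent_ge h (by linarith) (by linarith)
    have e2 : ‖G s (Z t - Z s)‖ ≤ ‖G‖ * (‖Z‖ * (t - s) ^ α) := by
      refine ((G s).le_opNorm _).trans ?_
      have := norm_sub_le hα0 Z s t
      rw [abs_of_nonneg hts] at this
      gcongr
      exact norm_apply_le G s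
    calc ‖I t - I s‖ = ‖(I t - I s - G s (Z t - Z s)) + G s (Z t - Z s)‖ := by
          rw [sub_add_cancel]
      _ ≤ sewingConst (2 * α) * (‖G‖ * ‖Z‖) * (t - s) ^ (2 * α) + ‖G‖ * (‖Z‖ * (t - s) ^ α) :=
          (norm_add_le _ _).trans (add_le_add (hI s t h0 hst h1) e2)
      _ ≤ sewingConst (2 * α) * (‖G‖ * ‖Z‖) * (t - s) ^ α + ‖G‖ * (‖Z‖ * (t - s) ^ α) := by
          gcongr
      _ = _ := by ring
  have hK0 : 0 ≤ (1 + sewingConst (2 * α)) * ‖G‖ * ‖Z‖ := by positivity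
  have hinc' : ∀ s t, ‖I (c t) - I (c s)‖ ≤
      (1 + sewingConst (2 * α)) * ‖G‖ * ‖Z‖ * |c t - c s| ^ α := by
    intro s t
    rcases le_total (c s) (c t) with h | h
    · rw [abs_of_nonneg (sub_nonneg.2 h)]
      exact hinc _ _ (hc s).1 h (hc t).2
    · rw [norm_sub_rev, abs_sub_comm, abs_of_nonneg (sub_nonneg.2 h)]
      exact hinc _ _ (hc t).1 h (hc s).2
  obtain ⟨J, hJ, hJK⟩ := exists_of_bound (α := α) hK0 (f := fun t => I (c t) - I 0) (fun t => by
      have := hinc' 0 t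
      rw [hcc 0 le_rfl zero_le_one] at this
      refine this.trans (mul_le_of_le_one_right hK0 (Real.rpow_le_one (abs_nonneg _) ?_ hα0.le))
      rw [sub_zero, abs_of_nonneg (hc t).1]
      exact (hc t).2) (fun s t => by
      rw [sub_sub_sub_cancel_right]
      refine (hinc' s t).trans ?_
      exact mul_le_mul_of_nonneg_left (Real.rpow_le_rpow (abs_nonneg _)
        (abs_clamp_sub_le 0 1 s t) hα0.le) hK0)
  refine ⟨J, ⟨?_, ⟨sewingConst (2 * α) * (‖G‖ * ‖Z‖), by positivity, fun s t h0 hst h1 => ?_⟩,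
    fun t => ?_⟩, hJK⟩
  · rw [hJ, hcc 0 le_rfl zero_le_one, sub_self]
  · rw [hJ, hJ, hcc s h0 (hst.trans h1), hcc t (h0.trans hst) h1, sub_sub_sub_cancel_right]
    exact hI s t h0 hst h1
  · rw [hJ, hJ]
    change I (c t) - I 0 = I (c (c t)) - I 0
    rw [hcc (c t) (hc t).1 (hc t).2]

lemma integral_unique (hα : 1 / 2 < α) {G : HolderPath α (E →L[ℝ] F)} {Z : HolderPath α E}
    {J J' : HolderPath α F}
    (hJ : IsIntegral G Z J) (hJ' : IsIntegral G Z J') : J = J' := by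
  refine ext fun t => ?_
  rw [hJ.2.2 t, hJ'.2.2 t]
  have h0 : 0 ≤ max 0 (min 1 t) := le_max_left _ _
  have h1 : max 0 (min 1 t) ≤ 1 := max_le zero_le_one (min_le_left _ _)
  have := (hJ.2.1.mono le_rfl h1).unique hα h0 (hJ'.2.1.mono le_rfl h1)
  rwa [hJ.1, hJ'.1, sub_zero, sub_zero] at this

lemma integral_add {G G' G₁ : HolderPath α (E →L[ℝ] F)} {Z Z' Z₁ : HolderPath α E}
    {J J' : HolderPath α F} (hJ : IsIntegral G Z J) (hJ' : IsIntegral G' Z' J')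
    (h : ∀ s t, G₁ s (Z₁ t - Z₁ s) = G s (Z t - Z s) + G' s (Z' t - Z' s)) :
    IsIntegral G₁ Z₁ (J + J') :=
  ⟨by rw [add_apply, hJ.1, hJ'.1, add_zero], hJ.2.1.add hJ'.2.1 h,
    fun t => by rw [add_apply, add_apply, hJ.2.2 t, hJ'.2.2 t]⟩

lemma integral_smul (c : ℝ) {G G₁ : HolderPath α (E →L[ℝ] F)} {Z Z₁ : HolderPath α E}
    {J : HolderPath α F} (hJ : IsIntegral G Z J)
    (h : ∀ s t, G₁ s (Z₁ t - Z₁ s) = c • G s (Z t - Z s)) :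
    IsIntegral G₁ Z₁ (c • J) :=
  ⟨by rw [smul_apply, hJ.1, smul_zero], hJ.2.1.smul c h,
    fun t => by rw [smul_apply, smul_apply, hJ.2.2 t]⟩

variable [ProperSpace F]

/-- The indefinite Young integral `t ↦ ∫₀ᵗ G dZ` for `t ∈ [0, 1]`, extended by constants. -/
noncomputable def integral (hα : 1 / 2 < α) :
    HolderPath α (E →L[ℝ] F) →L[ℝ] HolderPath α E →L[ℝ] HolderPath α F :=
  LinearMap.mkContinuous₂ (LinearMap.mk₂ ℝ (fun G Z => (exists_integral hα G Z).choose)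
    (fun G G' Z => integral_unique hα (exists_integral hα (G + G') Z).choose_spec.1
      (integral_add (exists_integral hα G Z).choose_spec.1
        (exists_integral hα G' Z).choose_spec.1 fun s t => by
          rw [add_apply, _root_.add_apply]))
    (fun c G Z => integral_unique hα (exists_integral hα (c • G) Z).choose_spec.1
      (integral_smul c (exists_integral hα G Z).choose_spec.1 fun s t => by
          rw [smul_apply, _root_.smul_apply]))
    (fun G Z Z' => integral_unique hα (exists_integral hα G (Z + Z')).choose_spec.1
      (integral_add (exists_integral hα G Z).choose_spec.1
        (exists_integral hα G Z').choose_spec.1 fun s t => by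
          rw [add_apply, add_apply, add_sub_add_comm, map_add]))
    (fun c G Z => integral_unique hα (exists_integral hα G (c • Z)).choose_spec.1
      (integral_smul c (exists_integral hα G Z).choose_spec.1 fun s t => by
          rw [smul_apply, smul_apply, ← smul_sub, map_smul])))
    (1 + sewingConst (2 * α)) fun G Z => (exists_integral hα G Z).choose_spec.2

lemma integral_spec (hα : 1 / 2 < α) (G : HolderPath α (E →L[ℝ] F)) (Z : HolderPath α E) :
    IsIntegral G Z (integral hα G Z) :=
  (exists_integral hα G Z).choose_spec.1

end HolderPath

/-! ### Superposition operators on Hölder paths -/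

section Calculus

lemma norm_le_of_mem_segment {E : Type*} [NormedAddCommGroup E] [NormedSpace ℝ E]
    {x y z : E} {R : ℝ} (hx : ‖x‖ ≤ R) (hy : ‖y‖ ≤ R)
    (hz : z ∈ segment ℝ x y) : ‖z‖ ≤ R := by
  have := (convex_closedBall (0 : E) R).segment_subset (by simpa using hx) (by simpa using hy) hz
  simpa using this

universe u
variable {E F : Type u} [NormedAddCommGroup E] [NormedSpace ℝ E] [ProperSpace E]
  [NormedAddCommGroup F] [NormedSpace ℝ F]

lemma exists_lipschitz_bound {V : E → F} (hV : ContDiff ℝ 1 V) (R : ℝ) :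
    ∃ L, 0 ≤ L ∧ (∀ x, ‖x‖ ≤ R → ‖fderiv ℝ V x‖ ≤ L) ∧
      ∀ x y, ‖x‖ ≤ R → ‖y‖ ≤ R → ‖V y - V x‖ ≤ L * ‖y - x‖ := by
  obtain ⟨L, hL⟩ := (isCompact_closedBall (0 : E) R).exists_bound_of_continuousOn
    (hV.continuous_fderiv one_ne_zero).continuousOn
  have hL' : ∀ x, ‖x‖ ≤ R → ‖fderiv ℝ V x‖ ≤ max L 0 := fun x hx =>
    (hL x (by simpa using hx)).trans (le_max_left _ _)
  refine ⟨max L 0, le_max_right _ _, hL', fun x y hx hy => ?_⟩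
  exact (convex_closedBall (0 : E) R).norm_image_sub_le_of_norm_fderiv_le
    (fun z _ => hV.differentiable one_ne_zero z) (fun z hz => hL' z (by simpa using hz))
    (by simpa using hx) (by simpa using hy)

/-- First order Taylor expansion with a uniform quadratic bound on balls. -/
lemma exists_taylor_bound {V : E → F} (hV : ContDiff ℝ 2 V) (R : ℝ) :
    ∃ L, 0 ≤ L ∧ (∀ x y, ‖x‖ ≤ R → ‖y‖ ≤ R → ‖fderiv ℝ V y - fderiv ℝ V x‖ ≤ L * ‖y - x‖) ∧
      ∀ x y z δ, ‖x‖ ≤ R → ‖y‖ ≤ R → ‖z‖ ≤ R → ‖y - x‖ ≤ δ → ‖z - x‖ ≤ δ →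
        ‖V z - V y - fderiv ℝ V x (z - y)‖ ≤ L * δ * ‖z - y‖ := by
  obtain ⟨L, hL, -, H⟩ := exists_lipschitz_bound (hV.fderiv_right (m := 1) le_rfl) R
  refine ⟨L, hL, H, fun x y z δ hx hy hz hyδ hzδ => ?_⟩
  refine (convex_segment y z).norm_image_sub_le_of_norm_fderiv_le'
    (fun w _ => hV.differentiable two_ne_zero w) (fun w hw => ?_)
    (left_mem_segment ℝ y z) (right_mem_segment ℝ y z)
  refine (H x w hx (norm_le_of_mem_segment hy hz hw)).trans ?_
  gcongr
  have := (convex_closedBall x δ).segment_subset (by simpa [dist_eq_norm] using hyδ)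
    (by simpa [dist_eq_norm] using hzδ) hw
  simpa [dist_eq_norm] using this

/-- The remainder of the first order expansion of `V` depends on the base point with a Lipschitz
constant of second order in the increment. -/
lemma exists_remainder_bound {V : E → F} (hV : ContDiff ℝ 3 V) (R : ℝ) :
    ∃ L, 0 ≤ L ∧ ∀ x y h δ, ‖x‖ + δ ≤ R → ‖y‖ + δ ≤ R → ‖h‖ ≤ δ →
        ‖(V (y + h) - V y - fderiv ℝ V y h) - (V (x + h) - V x - fderiv ℝ V x h)‖ ≤
          L * δ ^ 2 * ‖y - x‖ := by
  have hW : ContDiff ℝ 2 (fderiv ℝ V) := hV.fderiv_right (by norm_num)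
  obtain ⟨L, hL, H, -⟩ := exists_taylor_bound hW R
  refine ⟨L, hL, fun x y h δ hx hy hh => ?_⟩
  have hδ : 0 ≤ δ := (norm_nonneg h).trans hh
  have hd : Differentiable ℝ V := hV.differentiable (by norm_num)
  have hdW : Differentiable ℝ (fderiv ℝ V) := hW.differentiable (by norm_num)
  have hball : ∀ {u k : E}, ‖u‖ + δ ≤ R → ‖k‖ ≤ δ → ‖u + k‖ ≤ R := fun hu hk =>
    (norm_add_le _ _).trans (by linarith)
  have hxR : ‖x‖ ≤ R := by linarith
  have hyR : ‖y‖ ≤ R := by linarith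
  -- the mixed second difference of the derivative
  have key : ∀ k : E, ‖k‖ ≤ δ → ‖(fderiv ℝ V (y + k) - fderiv ℝ V y)
      - (fderiv ℝ V (x + k) - fderiv ℝ V x)‖ ≤ L * δ * ‖y - x‖ := by
    intro k hk
    have hder : ∀ u, HasFDerivAt (fun u => fderiv ℝ V (u + k) - fderiv ℝ V u)
        (fderiv ℝ (fderiv ℝ V) (u + k) - fderiv ℝ (fderiv ℝ V) u) u := fun u =>
      ((hasFDerivAt_comp_add_right k).2 (hdW (u + k)).hasFDerivAt).sub (hdW u).hasFDerivAt
    refine (convex_segment x y).norm_image_sub_le_of_norm_hasFDerivWithin_le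
      (fun w _ => (hder w).hasFDerivWithinAt) (fun w hw => ?_)
      (left_mem_segment ℝ x y) (right_mem_segment ℝ x y)
    have hwR : ‖w‖ + δ ≤ R := by
      have := norm_le_of_mem_segment (R := R - δ) (by linarith) (by linarith) hw
      linarith
    refine (H w (w + k) (by linarith) (hball hwR hk)).trans ?_
    rw [add_sub_cancel_left]
    gcongr
  have hder : ∀ k, HasFDerivAt (fun k => (V (y + k) - V y - fderiv ℝ V y k)
      - (V (x + k) - V x - fderiv ℝ V x k))
      ((fderiv ℝ V (y + k) - fderiv ℝ V y) - (fderiv ℝ V (x + k) - fderiv ℝ V x)) k := fun k =>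
    ((((hasFDerivAt_comp_add_left y).2 (hd (y + k)).hasFDerivAt).sub_const _).sub
      (fderiv ℝ V y).hasFDerivAt).sub
      ((((hasFDerivAt_comp_add_left x).2 (hd (x + k)).hasFDerivAt).sub_const _).sub
      (fderiv ℝ V x).hasFDerivAt)
  have := (convex_closedBall (0 : E) δ).norm_image_sub_le_of_norm_hasFDerivWithin_le
    (fun w _ => (hder w).hasFDerivWithinAt) (fun w hw => key w (by simpa using hw))
    (x := 0) (y := h) (by simpa using hδ) (by simpa using hh)
  simp only [add_zero, sub_self, map_zero, sub_zero] at this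
  refine this.trans ?_
  calc L * δ * ‖y - x‖ * ‖h‖ ≤ L * δ * ‖y - x‖ * δ := by gcongr
    _ = _ := by ring

namespace HolderPath

variable {α : ℝ}

lemma exists_comp (hα : 0 < α) {V : E → F} (hV : ContDiff ℝ ∞ V) (x : HolderPath α E) :
    ∃ y : HolderPath α F, ∀ t, y t = V (x t) := by
  obtain ⟨L, hL, -, H⟩ := exists_lipschitz_bound (contDiff_infty.1 hV 1) ‖x‖
  have hx := norm_apply_le x
  obtain ⟨y, hy, -⟩ := exists_of_bound (α := α) (K := ‖V 0‖ + L * ‖x‖) (f := fun t => V (x t))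
    (by positivity) (fun t => by
      have h0 := H 0 (x t) (by simp) (hx t)
      rw [sub_zero] at h0
      calc ‖V (x t)‖ = ‖V 0 + (V (x t) - V 0)‖ := by rw [add_sub_cancel]
        _ ≤ ‖V 0‖ + L * ‖x t‖ := (norm_add_le _ _).trans (by gcongr)
        _ ≤ _ := by gcongr; exact hx t) (fun s t => by
      have h0 : 0 ≤ |t - s| ^ α := Real.rpow_nonneg (abs_nonneg _) _
      calc ‖V (x t) - V (x s)‖ ≤ L * ‖x t - x s‖ := H _ _ (hx s) (hx t)
        _ ≤ L * (‖x‖ * |t - s| ^ α) := by gcongr; exact norm_sub_le hα x s t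
        _ = L * ‖x‖ * |t - s| ^ α := by ring
        _ ≤ _ := by gcongr; linarith [norm_nonneg (V 0)])
  exact ⟨y, hy⟩

/-- The superposition operator `x ↦ V ∘ x` on Hölder paths. -/
noncomputable def comp (hα : 0 < α) {V : E → F} (hV : ContDiff ℝ ∞ V) (x : HolderPath α E) :
    HolderPath α F := (exists_comp hα hV x).choose

@[simp] lemma comp_apply (hα : 0 < α) {V : E → F} (hV : ContDiff ℝ ∞ V) (x : HolderPath α E)
    (t : ℝ) : comp hα hV x t = V (x t) := (exists_comp hα hV x).choose_spec t

lemma hasFDerivAt_comp (hα : 0 < α) {V : E → F} (hV : ContDiff ℝ ∞ V) (x : HolderPath α E) :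
    HasFDerivAt (comp hα hV)
      (pointwise hα (comp hα (hV.fderiv_right (m := ∞) le_rfl) x)) x := by
  set R := ‖x‖ + 2 with hR
  obtain ⟨L, hL, -, H⟩ := exists_taylor_bound (contDiff_infty.1 hV 2) R
  obtain ⟨L', hL', H'⟩ := exists_remainder_bound (contDiff_infty.1 hV 3) R
  rw [hasFDerivAt_iff_isLittleO_nhds_zero]
  have hO : (fun h : HolderPath α E => comp hα hV (x + h) - comp hα hV x
      - pointwise hα (comp hα (hV.fderiv_right (m := ∞) le_rfl) x) h)
      =O[𝓝 0] fun h => ‖h‖ ^ 2 := by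
    refine Asymptotics.IsBigO.of_bound (L + L' * ‖x‖) ?_
    filter_upwards [Metric.ball_mem_nhds (0 : HolderPath α E) one_pos] with h hh
    have hh1 : ‖h‖ ≤ 1 := by simpa using (mem_ball_zero_iff.1 hh).le
    rw [norm_pow, norm_norm]
    have hxt := norm_apply_le x
    have hht := norm_apply_le h
    have hb : ∀ s t, ‖x t + h s‖ ≤ R := fun s t =>
      (norm_add_le _ _).trans (by linarith [hxt t, hht s])
    have hrem : ∀ t, (comp hα hV (x + h) - comp hα hV x
        - pointwise hα (comp hα (hV.fderiv_right (m := ∞) le_rfl) x) h : HolderPath α F) t =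
        V (x t + h t) - V (x t) - fderiv ℝ V (x t) (h t) := fun t => by simp
    refine norm_le (by positivity) (fun t => ?_) fun s t => ?_
    · rw [hrem]
      have := H (x t) (x t) (x t + h t) ‖h‖ (by linarith [hxt t]) (by linarith [hxt t]) (hb t t)
        (by simp) (by simpa using hht t)
      rw [add_sub_cancel_left] at this
      calc _ ≤ L * ‖h‖ * ‖h t‖ := this
        _ ≤ L * ‖h‖ * ‖h‖ := by gcongr; exact hht t
        _ = L * ‖h‖ ^ 2 := by ring
        _ ≤ (L + L' * ‖x‖) * ‖h‖ ^ 2 := by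
          gcongr
          exact le_add_of_nonneg_right (by positivity)
    · rw [hrem, hrem]
      have e : (V (x t + h t) - V (x t) - fderiv ℝ V (x t) (h t)) -
          (V (x s + h s) - V (x s) - fderiv ℝ V (x s) (h s)) =
          ((V (x t + h t) - V (x t) - fderiv ℝ V (x t) (h t)) -
          (V (x s + h t) - V (x s) - fderiv ℝ V (x s) (h t))) +
          (V (x s + h t) - V (x s + h s) - fderiv ℝ V (x s) ((x s + h t) - (x s + h s))) := by
        rw [add_sub_add_left_eq_sub, map_sub]; abel
      rw [e]
      have e1 := H' (x s) (x t) (h t) ‖h‖ (by linarith [hxt s]) (by linarith [hxt t]) (hht t)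
      have e2 := H (x s) (x s + h s) (x s + h t) ‖h‖ (by linarith [hxt s]) (hb s s) (hb t s)
        (by simpa using hht s) (by simpa using hht t)
      rw [add_sub_add_left_eq_sub] at e2
      have h0 : 0 ≤ |t - s| ^ α := Real.rpow_nonneg (abs_nonneg _) _
      calc _ ≤ L' * ‖h‖ ^ 2 * ‖x t - x s‖ + L * ‖h‖ * ‖h t - h s‖ := by
            rw [add_sub_add_left_eq_sub]
            exact (norm_add_le _ _).trans (add_le_add e1 e2)
        _ ≤ L' * ‖h‖ ^ 2 * (‖x‖ * |t - s| ^ α) + L * ‖h‖ * (‖h‖ * |t - s| ^ α) := by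
            gcongr
            · exact norm_sub_le hα x s t
            · exact norm_sub_le hα h s t
        _ = _ := by ring
  refine hO.trans_isLittleO ?_
  exact Asymptotics.isLittleO_norm_pow_id one_lt_two

/-- The superposition operator of a smooth function is smooth: its derivative is again built from
the superposition operator of a smooth function. -/
theorem contDiff_comp (hα : 0 < α) {V : E → F} (hV : ContDiff ℝ ∞ V) :
    ContDiff ℝ ∞ (comp hα hV) := by
  rw [contDiff_infty]
  intro n
  induction n generalizing F with
  | zero =>
    exact contDiff_zero.2 (continuous_iff_continuousAt.2 fun x =>
      (hasFDerivAt_comp hα hV x).continuousAt)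
  | succ n ih =>
    refine contDiff_succ_iff_hasFDerivAt.2 ⟨_, ?_, hasFDerivAt_comp hα hV⟩
    exact (pointwise hα).contDiff.comp (ih (hV.fderiv_right (m := ∞) le_rfl))

end HolderPath

end Calculus

/-! ### Local solutions in a vector space -/

section Local

universe u
variable {α : ℝ} {E A : Type u} [NormedAddCommGroup E] [NormedSpace ℝ E] [ProperSpace E]
  [NormedAddCommGroup A] [NormedSpace ℝ A] {V : E → A →L[ℝ] E}

namespace HolderPath

lemma continuous_path {E : Type*} [NormedAddCommGroup E] [NormedSpace ℝ E] (hα : 0 < α)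
    (x : HolderPath α E) : Continuous x := by
  refine continuous_iff_continuousAt.2 fun t => ?_
  rw [ContinuousAt, tendsto_iff_norm_sub_tendsto_zero]
  have h : Tendsto (fun s : ℝ => ‖x‖ * |s - t| ^ α) (𝓝 t) (𝓝 (‖x‖ * |t - t| ^ α)) := by
    refine ContinuousAt.tendsto (f := fun s : ℝ => ‖x‖ * |s - t| ^ α) ?_
    exact continuousAt_const.mul
      (ContinuousAt.rpow_const (by fun_prop) (Or.inr hα.le))
  rw [sub_self, abs_zero, Real.zero_rpow hα.ne', mul_zero] at h
  exact squeeze_zero (fun _ => norm_nonneg _) (fun s => norm_sub_le hα x t s) h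

lemma continuous_eval_prod {E : Type*} [NormedAddCommGroup E] [NormedSpace ℝ E] (hα : 0 < α) :
    Continuous fun q : HolderPath α E × ℝ => q.1 q.2 := by
  refine continuous_iff_continuousAt.2 fun ⟨x, t⟩ => ?_
  rw [ContinuousAt, tendsto_iff_norm_sub_tendsto_zero]
  have h1 : Tendsto (fun q : HolderPath α E × ℝ => ‖q.1 - x‖ + ‖x q.2 - x t‖) (𝓝 (x, t))
      (𝓝 (‖x - x‖ + ‖x t - x t‖)) := by
    refine ContinuousAt.tendsto (f := fun q : HolderPath α E × ℝ => ‖q.1 - x‖ + ‖x q.2 - x t‖) ?_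
    have := (continuous_path hα x)
    fun_prop
  rw [sub_self, sub_self, norm_zero, norm_zero, add_zero] at h1
  refine squeeze_zero (fun _ => norm_nonneg _) (fun q => ?_) h1
  calc ‖q.1 q.2 - x t‖ = ‖(q.1 - x) q.2 + (x q.2 - x t)‖ := by rw [sub_apply, sub_add_sub_cancel]
    _ ≤ _ := (norm_add_le _ _).trans (by gcongr; exact norm_apply_le _ _)

/-- `x` solves the equation `x t = p + ∫₀ᵗ V(x) dZ` on `[0, 1]`. -/
def IsFixedPath (hα : 1 / 2 < α) (hV : ContDiff ℝ ∞ V) (Z : HolderPath α A) (p : E)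
    (x : HolderPath α E) : Prop :=
  x - const α E p - integral hα (comp (by linarith) hV x) Z = 0

lemma isFixedPath_iff (hα : 1 / 2 < α) (hV : ContDiff ℝ ∞ V) (Z : HolderPath α A) (p : E)
    (x : HolderPath α E) : IsFixedPath hα hV Z p x ↔
      x 0 = p ∧ HasYoungGerm α 0 1 (fun t => V (x t)) Z x ∧ ∀ t, x t = x (max 0 (min 1 t)) := by
  have hint := integral_spec hα (comp (by linarith) hV x) Z
  have hcomp : (comp (by linarith) hV x : HolderPath α (A →L[ℝ] E)).path = fun t => V (x t) :=
    funext fun t => comp_apply _ hV x t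
  have hgerm : ∀ {J : ℝ → E} (c : E), HasYoungGerm α 0 1 (fun t => V (x t)) Z J →
      HasYoungGerm α 0 1 (fun t => V (x t)) Z (fun t => J t + c) := by
    rintro J c ⟨C, hC, H⟩
    exact ⟨C, hC, fun s t h1 h2 h3 => by rw [add_sub_add_right_eq_sub]; exact H s t h1 h2 h3⟩
  constructor
  · intro h
    have hx : ∀ t, x t = integral hα (comp (by linarith) hV x) Z t + p := fun t => by
      have h := congrArg (fun y : HolderPath α E => y t) h
      simp only [sub_apply, const_apply, zero_apply] at h
      rw [sub_eq_zero] at h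
      rw [← h, sub_add_cancel]
    refine ⟨by rw [hx, hint.1, zero_add], ?_, fun t => by rw [hx t, hint.2.2, ← hx]⟩
    have h2 := hint.2.1
    rw [hcomp] at h2
    refine (hgerm p h2).congr (fun _ _ => rfl) (fun _ _ => rfl) fun t _ => hx t
  · rintro ⟨h0, hg, hcl⟩
    have : IsIntegral (comp (by linarith) hV x) Z (x - const α E p) := by
      refine ⟨by rw [sub_apply, const_apply, h0, sub_self], ?_, fun t => by
        rw [sub_apply, sub_apply, const_apply, const_apply, hcl t]⟩
      rw [hcomp]
      exact (hgerm (-p) hg).congr (fun _ _ => rfl) (fun _ _ => rfl) fun t _ => by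
        rw [sub_apply, const_apply, sub_eq_add_neg]
    exact sub_eq_zero.2 (integral_unique hα this hint)

/-- The map `(a, x) ↦ (a, x - K a)` is invertible. -/
noncomputable def shear {X Y : Type*} [NormedAddCommGroup X] [NormedSpace ℝ X]
    [NormedAddCommGroup Y] [NormedSpace ℝ Y] (K : X →L[ℝ] Y) : (X × Y) ≃L[ℝ] (X × Y) :=
  ContinuousLinearEquiv.equivOfInverse
    ((ContinuousLinearMap.fst ℝ X Y).prod
      (ContinuousLinearMap.snd ℝ X Y - K.comp (ContinuousLinearMap.fst ℝ X Y)))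
    ((ContinuousLinearMap.fst ℝ X Y).prod
      (ContinuousLinearMap.snd ℝ X Y + K.comp (ContinuousLinearMap.fst ℝ X Y)))
    (fun w => by simp) (fun w => by simp)

/-- Local solvability, by the inverse function theorem in Hölder spaces: at the zero driver and the
constant path `p₀`, the derivative of the equation with respect to the unknown path is the
identity. -/
theorem exists_solution_map [CompleteSpace A] (hα : 1 / 2 < α) (hV : ContDiff ℝ ∞ V) (p₀ : E)
    {r : ℝ} (hr : 0 < r) :
    ∃ ε > 0, ∃ S : HolderPath α A → E → HolderPath α E, ∀ Z : HolderPath α A, ‖Z‖ < ε →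
      ContDiffOn ℝ ∞ (S Z) (Metric.ball p₀ ε) ∧
      ∀ p ∈ Metric.ball p₀ ε, IsFixedPath hα hV Z p (S Z p) ∧ ‖S Z p - const α E p₀‖ < r ∧
        ∀ x : HolderPath α E, ‖x - const α E p₀‖ < ε → IsFixedPath hα hV Z p x → x = S Z p := by
  have hα0 : 0 < α := by linarith
  let X := HolderPath α A × E
  let Y := HolderPath α E
  let Ψ : X × Y → X × Y := fun w =>
    (w.1, w.2 - const α E w.1.2 - integral hα (comp hα0 hV w.2) w.1.1)
  have hΨ : ContDiff ℝ ∞ Ψ := by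
    refine contDiff_fst.prodMk ((contDiff_snd.sub ((const α E).contDiff.comp
      (contDiff_snd.comp contDiff_fst))).sub ?_)
    exact (((integral hα).contDiff.comp ((contDiff_comp hα0 hV).comp contDiff_snd)).clm_apply
      (contDiff_fst.comp contDiff_fst))
  let w₀ : X × Y := ((0, p₀), const α E p₀)
  let K : X →L[ℝ] Y := (const α E).comp (ContinuousLinearMap.snd ℝ _ _) +
    (integral hα (comp hα0 hV (const α E p₀))).comp (ContinuousLinearMap.fst ℝ _ _)
  have hderiv : HasFDerivAt Ψ (shear K : X × Y →L[ℝ] X × Y) w₀ := by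
    have h0 : HasFDerivAt (fun w : X × Y => comp hα0 hV w.2)
        ((pointwise hα0 (comp hα0 (hV.fderiv_right (m := ∞) le_rfl) (const α E p₀))).comp
          (ContinuousLinearMap.snd ℝ X Y)) w₀ :=
      HasFDerivAt.comp (g := comp hα0 hV) (f := (Prod.snd : X × Y → Y)) w₀
        (hasFDerivAt_comp hα0 hV (const α E p₀)) hasFDerivAt_snd
    have h1 : HasFDerivAt (fun w : X × Y => integral hα (comp hα0 hV w.2))
        ((integral (E := A) (F := E) hα).comp _) w₀ :=
      (integral (E := A) (F := E) hα).hasFDerivAt.comp w₀ h0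
    have h2 : HasFDerivAt (fun w : X × Y => w.1.1)
        ((ContinuousLinearMap.fst ℝ (HolderPath α A) E).comp (ContinuousLinearMap.fst ℝ X Y)) w₀ :=
      ((ContinuousLinearMap.fst ℝ (HolderPath α A) E).comp
        (ContinuousLinearMap.fst ℝ X Y)).hasFDerivAt
    have h3 := h1.clm_apply h2
    have h4 : HasFDerivAt (fun w : X × Y => const α E w.1.2)
        ((const α E).comp ((ContinuousLinearMap.snd ℝ (HolderPath α A) E).comp
          (ContinuousLinearMap.fst ℝ X Y))) w₀ :=
      ((const α E).comp ((ContinuousLinearMap.snd ℝ (HolderPath α A) E).comp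
        (ContinuousLinearMap.fst ℝ X Y))).hasFDerivAt
    have h5 := (hasFDerivAt_fst (𝕜 := ℝ) (p := w₀)).prodMk
      (((hasFDerivAt_snd (𝕜 := ℝ) (p := w₀)).sub h4).sub h3)
    refine h5.congr_fderiv ?_
    refine ContinuousLinearMap.ext fun w => ?_
    refine Prod.ext rfl ?_
    simp [shear, K, w₀, sub_sub]
    rfl
  let e := hΨ.contDiffAt.toOpenPartialHomeomorph Ψ hderiv (by simp)
  have he : ∀ w, e w = Ψ w := fun w => rfl
  have hw₀ : w₀ ∈ e.source := hΨ.contDiffAt.mem_toOpenPartialHomeomorph_source hderiv (by simp)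
  let O : Set (X × Y) := {w | fderiv ℝ Ψ w ∈ range (fun f : (X × Y) ≃L[ℝ] (X × Y) =>
      (f : (X × Y) →L[ℝ] (X × Y)))} ∩
    {w | ‖w.2 - const α E p₀‖ < r}
  have hO : IsOpen O := by
    refine (ContinuousLinearEquiv.isOpen.preimage (hΨ.continuous_fderiv (by simp))).inter ?_
    exact isOpen_lt (by fun_prop) continuous_const
  have hw₀O : w₀ ∈ O := ⟨⟨shear K, hderiv.fderiv.symm⟩, by simpa [w₀] using hr⟩
  let e' := e.restrOpen O hO
  have he's : e'.source = e.source ∩ O := e.restrOpen_source O hO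
  have he' : ∀ w, e' w = Ψ w := fun w => rfl
  have hw₀' : w₀ ∈ e'.source := by rw [he's]; exact ⟨hw₀, hw₀O⟩
  have hΨ0 : Ψ w₀ = ((0, p₀), 0) := by simp [Ψ, w₀]
  have htar : e'.target ∈ 𝓝 (((0, p₀), 0) : X × Y) := by
    rw [← hΨ0, ← he']
    exact e'.open_target.mem_nhds (e'.map_source hw₀')
  obtain ⟨ε₁, hε₁, hb₁⟩ := Metric.mem_nhds_iff.1 htar
  obtain ⟨ε₂, hε₂, hb₂⟩ := Metric.mem_nhds_iff.1 (e'.open_source.mem_nhds hw₀')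
  have hmem₁ : ∀ Z : HolderPath α A, ‖Z‖ < ε₁ → ∀ p ∈ Metric.ball p₀ ε₁,
      (((Z, p), 0) : X × Y) ∈ e'.target := fun Z hZ p hp => hb₁ (by
    rw [Metric.mem_ball, Prod.dist_eq, Prod.dist_eq, dist_self, dist_zero_right]
    exact max_lt (max_lt hZ hp) hε₁)
  refine ⟨min ε₁ ε₂, lt_min hε₁ hε₂, fun Z p => (e'.symm ((Z, p), 0)).2, fun Z hZ => ⟨?_, ?_⟩⟩
  · intro p hp
    have hZ1 := hZ.trans_le (min_le_left _ _)
    have hp1 := Metric.ball_subset_ball (min_le_left ε₁ ε₂) hp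
    have ht := hmem₁ Z hZ1 p hp1
    have hs := e'.map_target ht
    rw [he's] at hs
    obtain ⟨f', hf'⟩ := hs.2.1
    dsimp only at hf'
    have h1 : ContDiffAt ℝ ∞ e'.symm (((Z, p), 0) : X × Y) :=
      e'.contDiffAt_symm ht (f₀' := f') (by
        rw [hf']
        exact (hΨ.differentiable (by simp) _).hasFDerivAt) hΨ.contDiffAt
    have h2 : ContDiffAt ℝ ∞ (fun p : E => (((Z, p), 0) : X × Y)) p := by fun_prop
    exact (contDiffAt_snd.comp p (h1.comp p h2)).contDiffWithinAt
  · intro p hp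
    have hZ1 := hZ.trans_le (min_le_left _ _)
    have hp1 := Metric.ball_subset_ball (min_le_left ε₁ ε₂) hp
    have ht := hmem₁ Z hZ1 p hp1
    have hs := e'.map_target ht
    have hr' := e'.right_inv ht
    rw [he'] at hr'
    have hfst : (e'.symm (((Z, p), 0) : X × Y)).1 = (Z, p) := congrArg Prod.fst hr'
    rw [he's] at hs
    refine ⟨?_, hs.2.2, fun x hx hfix => ?_⟩
    · have := congrArg Prod.snd hr'
      simp only [Ψ, hfst] at this
      exact this
    · have hx' : (((Z, p), x) : X × Y) ∈ e'.source := hb₂ (by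
        rw [Metric.mem_ball, Prod.dist_eq, Prod.dist_eq, dist_zero_right, dist_eq_norm x]
        exact max_lt (max_lt (hZ.trans_le (min_le_right _ _))
          (Metric.ball_subset_ball (min_le_right ε₁ ε₂) hp)) (hx.trans_le (min_le_right _ _)))
      have := e'.left_inv hx'
      rw [he'] at this
      have hΨx : Ψ ((Z, p), x) = ((Z, p), 0) := Prod.ext rfl hfix
      rw [hΨx] at this
      exact (congrArg Prod.snd this).symm

end HolderPath

end Local

/-! ### Local flows in a vector space -/

section LocalFlow

universe u
variable {α : ℝ} {E A : Type u} [NormedAddCommGroup E] [NormedSpace ℝ E]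
  [NormedAddCommGroup A] [NormedSpace ℝ A]

/-- The piece of the path `y` over `[a, a + h]`, rescaled to `[0, 1]`, shifted by a constant and
extended by constants, as an element of the Hölder space. -/
lemma exists_rescaled {y : ℝ → E} {a h C r : ℝ} (c : E) (hα : 0 < α) (hh : 0 ≤ h) (hC : 0 ≤ C)
    (hy : ∀ s t, a ≤ s → s ≤ t → t ≤ a + h → ‖y t - y s‖ ≤ C * (t - s) ^ α) (hr : C * h ^ α ≤ r) :
    ∃ x : HolderPath α E, (∀ u, x u = y (h * max 0 (min 1 u) + a) - c) ∧
      ‖x - HolderPath.const α E (y a - c)‖ ≤ r := by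
  have hr0 : 0 ≤ r := le_trans (mul_nonneg hC (Real.rpow_nonneg hh _)) hr
  have hmem : ∀ u : ℝ, 0 ≤ max 0 (min 1 u) ∧ max 0 (min 1 u) ≤ 1 := fun u =>
    ⟨le_max_left _ _, max_le zero_le_one (min_le_left _ _)⟩
  have key : ∀ s t, s ≤ t → ‖y (h * max 0 (min 1 t) + a) - y (h * max 0 (min 1 s) + a)‖ ≤
      r * |max 0 (min 1 t) - max 0 (min 1 s)| ^ α := by
    intro s t hst
    have hm : max 0 (min 1 s) ≤ max 0 (min 1 t) := max_le_max_left _ (min_le_min_left _ hst)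
    refine (hy _ _ (by nlinarith [hmem s]) (by gcongr) (by nlinarith [hmem t])).trans ?_
    rw [add_sub_add_right_eq_sub, ← mul_sub, Real.mul_rpow hh (sub_nonneg.2 hm), ← mul_assoc,
      abs_of_nonneg (sub_nonneg.2 hm)]
    exact mul_le_mul_of_nonneg_right hr (Real.rpow_nonneg (sub_nonneg.2 hm) _)
  have key' : ∀ s t, ‖y (h * max 0 (min 1 t) + a) - y (h * max 0 (min 1 s) + a)‖ ≤
      r * |max 0 (min 1 t) - max 0 (min 1 s)| ^ α := by
    intro s t
    rcases le_total s t with hst | hst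
    · exact key s t hst
    · rw [norm_sub_rev, abs_sub_comm]; exact key t s hst
  obtain ⟨x, hx, hxr⟩ := HolderPath.exists_of_bound (α := α) hr0
    (f := fun u => y (h * max 0 (min 1 u) + a) - y a) (fun t => by
      have := key' 0 t
      have h0 : max 0 (min 1 (0 : ℝ)) = 0 := by simp
      rw [h0, mul_zero, zero_add, sub_zero, abs_of_nonneg (hmem t).1] at this
      exact this.trans (mul_le_of_le_one_right hr0
        (Real.rpow_le_one (hmem t).1 (hmem t).2 hα.le))) (fun s t => by
      rw [sub_sub_sub_cancel_right]
      exact (key' s t).trans (mul_le_mul_of_nonneg_left (Real.rpow_le_rpow (abs_nonneg _)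
        (abs_clamp_sub_le 0 1 s t) hα.le) hr0))
  refine ⟨x + HolderPath.const α E (y a - c), fun u => ?_, by rwa [add_sub_cancel_right]⟩
  rw [HolderPath.add_apply, hx, HolderPath.const_apply]
  abel

lemma exists_pos_rpow_lt {ε : ℝ} (hα : 0 < α) (C : ℝ) (hε : 0 < ε) {b : ℝ} (hb : 0 < b) :
    ∃ h, 0 < h ∧ h ≤ b ∧ C * h ^ α < ε := by
  have hlim : Tendsto (fun h : ℝ => C * h ^ α) (𝓝 0) (𝓝 (C * 0 ^ α)) :=
    (Real.continuousAt_rpow_const 0 α (Or.inr hα.le)).const_mul C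
  rw [Real.zero_rpow hα.ne', mul_zero] at hlim
  have h1 := (hlim.mono_left (nhdsWithin_le_nhds (s := Ioi 0))).eventually (gt_mem_nhds hε)
  have h2 : ∀ᶠ h in 𝓝[>] (0 : ℝ), h ∈ Ioc 0 b := Ioc_mem_nhdsGT hb
  obtain ⟨h, h3, h4⟩ := (h1.and h2).exists
  exact ⟨h, h4.1, h4.2, h3⟩

variable [ProperSpace E] [CompleteSpace A] {V : E → A →L[ℝ] E} {Z : ℝ → A} {CZ : ℝ}

/-- The flow near a point on short intervals; the length of the intervals does not depend on the
initial time. -/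
theorem exists_local_flow (hα : 1 / 2 < α) (hV : ContDiff ℝ ∞ V) (hCZ : 0 ≤ CZ)
    (hZ : ∀ s t, ‖Z t - Z s‖ ≤ CZ * |t - s| ^ α) (p₀ : E) {r : ℝ} (hr : 0 < r) :
    ∃ ρ > 0, ∃ δ > 0, ∃ y : ℝ → E → ℝ → E, ∀ a : ℝ,
      (∀ p ∈ Metric.ball p₀ ρ, y a p a = p ∧ Continuous (y a p) ∧
        HasYoungGerm α a (a + δ) (fun t => V (y a p t)) Z (y a p) ∧
        ∀ t, y a p t ∈ Metric.ball p₀ r) ∧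
      (∀ t, ContDiffOn ℝ ∞ (fun p => y a p t) (Metric.ball p₀ ρ)) ∧
      ContinuousOn (fun q : ℝ × E => y a q.2 q.1) (univ ×ˢ Metric.ball p₀ ρ) := by
  have hα0 : 0 < α := by linarith
  obtain ⟨ε, hε, S, hS⟩ := HolderPath.exists_solution_map (A := A) hα hV p₀ hr
  obtain ⟨δ, hδ, -, hδε⟩ := exists_pos_rpow_lt hα0 CZ hε one_pos
  have hZ' : ∀ a s t, a ≤ s → s ≤ t → t ≤ a + δ → ‖Z t - Z s‖ ≤ CZ * (t - s) ^ α :=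
    fun a s t _ hst _ => by
      have := hZ s t
      rwa [abs_of_nonneg (sub_nonneg.2 hst)] at this
  choose ζ hζ hζ' using fun a => exists_rescaled (Z a) hα0 hδ.le hCZ (hZ' a) le_rfl
  have hζε : ∀ a, ‖ζ a‖ < ε := fun a => by
    have := hζ' a
    rw [sub_self, map_zero, sub_zero] at this
    exact this.trans_lt hδε
  refine ⟨ε, hε, δ, hδ, fun a p t => S (ζ a) p (δ⁻¹ * t + -(δ⁻¹ * a)), fun a => ⟨fun p hp => ?_,
    fun t => ?_, ?_⟩⟩
  · obtain ⟨hfix, hdist, -⟩ := (hS (ζ a) (hζε a)).2 p hp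
    obtain ⟨h0, hg, -⟩ := (HolderPath.isFixedPath_iff hα hV _ _ _).1 hfix
    refine ⟨?_, ?_, ?_, fun t => ?_⟩
    · beta_reduce
      rw [add_neg_cancel, h0]
    · exact (HolderPath.continuous_path hα0 (S (ζ a) p)).comp (by fun_prop)
    · have h := hg.comp_affine (a := a) (b := a + δ) (m := δ⁻¹) (c := -(δ⁻¹ * a))
        (inv_nonneg.2 hδ.le) (by simp) (le_of_eq (by field_simp; ring))
      obtain ⟨C, hC, H⟩ := h
      refine ⟨C, hC, fun s t h1 h2 h3 => ?_⟩
      have hval : ∀ t, a ≤ t → t ≤ a + δ → ζ a (δ⁻¹ * t + -(δ⁻¹ * a)) = Z t - Z a := by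
        intro t h1 h2
        have e : δ⁻¹ * t + -(δ⁻¹ * a) = (t - a) / δ := by field_simp; ring
        rw [hζ, e, min_eq_right ((div_le_one hδ).2 (by linarith)),
          max_eq_right (div_nonneg (by linarith) hδ.le), mul_div_cancel₀ _ hδ.ne', sub_add_cancel]
      have := H s t h1 h2 h3
      beta_reduce at this ⊢
      rw [hval s h1 (h2.trans h3), hval t (h1.trans h2) h3, sub_sub_sub_cancel_right] at this
      exact this
    · rw [mem_ball_iff_norm]
      have := HolderPath.norm_apply_le (S (ζ a) p - HolderPath.const α E p₀)
        (δ⁻¹ * t + -(δ⁻¹ * a))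
      rw [HolderPath.sub_apply, HolderPath.const_apply] at this
      exact this.trans_lt hdist
  · exact (HolderPath.eval α E _).contDiff.comp_contDiffOn (hS (ζ a) (hζε a)).1
  · refine (HolderPath.continuous_eval_prod hα0).comp_continuousOn (f := fun q : ℝ × E =>
      (S (ζ a) q.2, δ⁻¹ * q.1 + -(δ⁻¹ * a))) ?_
    refine ContinuousOn.prodMk ?_ (by fun_prop)
    exact (hS (ζ a) (hζε a)).1.continuousOn.comp continuousOn_snd fun q hq => hq.2

/-- Two solutions with the same initial value agree on a short interval. -/
theorem eqOn_short_of_hasYoungGerm (hα : 1 / 2 < α) (hV : ContDiff ℝ ∞ V) (hCZ : 0 ≤ CZ)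
    (hZ : ∀ s t, ‖Z t - Z s‖ ≤ CZ * |t - s| ^ α) {a b : ℝ} (hab : a < b) {y y' : ℝ → E}
    (hc : ContinuousOn y (Icc a b)) (hc' : ContinuousOn y' (Icc a b)) (h0 : y a = y' a)
    (hy : HasYoungGerm α a b (fun t => V (y t)) Z y)
    (hy' : HasYoungGerm α a b (fun t => V (y' t)) Z y') :
    ∃ h, 0 < h ∧ a + h ≤ b ∧ EqOn y y' (Icc a (a + h)) := by
  have hα0 : 0 < α := by linarith
  obtain ⟨ε, hε, S, hS⟩ := HolderPath.exists_solution_map (A := A) hα hV (y a) one_pos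
  have hZ' : ∀ s t, a ≤ s → s ≤ t → t ≤ b → ‖Z t - Z s‖ ≤ CZ * (t - s) ^ α :=
    fun s t _ hst _ => by
      have := hZ s t
      rwa [abs_of_nonneg (sub_nonneg.2 hst)] at this
  have hHolder : ∀ {x : ℝ → E}, ContinuousOn x (Icc a b) →
      HasYoungGerm α a b (fun t => V (x t)) Z x →
      ∃ C, 0 ≤ C ∧ ∀ s t, a ≤ s → s ≤ t → t ≤ b → ‖x t - x s‖ ≤ C * (t - s) ^ α := by
    intro x hx hg
    obtain ⟨B, hB⟩ := isCompact_Icc.exists_bound_of_continuousOn (hV.continuous.comp_continuousOn hx)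
    exact hg.norm_sub_le hα0.le (le_max_right B 0)
      (fun t ht => (hB t ht).trans (le_max_left _ _)) hZ'
  obtain ⟨C, hC, H⟩ := hHolder hc hy
  obtain ⟨C', hC', H'⟩ := hHolder hc' hy'
  obtain ⟨h, hh, hhb, hhε⟩ := exists_pos_rpow_lt hα0 (max CZ (max C C')) hε (sub_pos.2 hab)
  have hh0 : 0 ≤ h ^ α := Real.rpow_nonneg hh.le _
  have hbd : ∀ {K}, K ≤ max CZ (max C C') → K * h ^ α < ε := fun hK =>
    (mul_le_mul_of_nonneg_right hK hh0).trans_lt hhε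
  have hab' : a + h ≤ b := by linarith
  refine ⟨h, hh, hab', ?_⟩
  obtain ⟨ζ, hζ, hζ'⟩ := exists_rescaled (Z a) hα0 hh.le hCZ
    (fun s t h1 h2 h3 => hZ' s t h1 h2 (h3.trans hab')) le_rfl
  rw [sub_self, map_zero, sub_zero] at hζ'
  have hζε : ‖ζ‖ < ε := hζ'.trans_lt (hbd (le_max_left _ _))
  obtain ⟨-, -, huniq⟩ := (hS ζ hζε).2 (y a) (Metric.mem_ball_self hε)
  have hcl : ∀ u : ℝ, 0 ≤ u → u ≤ 1 → max 0 (min 1 u) = u := fun u h0 h1 => by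
    rw [min_eq_right h1, max_eq_right h0]
  have key : ∀ {x : ℝ → E} {K : ℝ}, 0 ≤ K → K ≤ max CZ (max C C') → x a = y a →
      HasYoungGerm α a b (fun t => V (x t)) Z x →
      (∀ s t, a ≤ s → s ≤ t → t ≤ b → ‖x t - x s‖ ≤ K * (t - s) ^ α) →
      ∀ u, 0 ≤ u → u ≤ 1 → x (h * u + a) = S ζ (y a) u := by
    intro x K hK0 hK hxa hg hx u hu0 hu1
    obtain ⟨ξ, hξ, hξ'⟩ := exists_rescaled 0 hα0 hh.le hK0
      (fun s t h1 h2 h3 => hx s t h1 h2 (h3.trans hab')) le_rfl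
    rw [sub_zero, hxa] at hξ'
    have hξv : ∀ u, 0 ≤ u → u ≤ 1 → ξ u = x (h * u + a) := fun u h0 h1 => by
      rw [hξ, hcl u h0 h1, sub_zero]
    rw [← hξv u hu0 hu1, ← huniq ξ (hξ'.trans_lt (hbd hK))]
    refine (HolderPath.isFixedPath_iff hα hV _ _ _).2 ⟨?_, ?_, fun t => ?_⟩
    · rw [hξv 0 le_rfl zero_le_one, mul_zero, zero_add, hxa]
    · obtain ⟨C, hC, H⟩ := hg.comp_affine (a := 0) (b := 1) (m := h) (c := a) hh.le (by simp)
        (by linarith)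
      refine ⟨C, hC, fun s t h1 h2 h3 => ?_⟩
      beta_reduce
      rw [hζ, hζ, sub_sub_sub_cancel_right, hcl s h1 (h2.trans h3), hcl t (h1.trans h2) h3,
        hξv s h1 (h2.trans h3), hξv t (h1.trans h2) h3]
      exact H s t h1 h2 h3
    · rw [hξ, hξ, hcl (max 0 (min 1 t)) (le_max_left _ _) (max_le zero_le_one (min_le_left _ _))]
  intro t ht
  have hu0 : 0 ≤ (t - a) / h := div_nonneg (by linarith [ht.1]) hh.le
  have hu1 : (t - a) / h ≤ 1 := (div_le_one hh).2 (by linarith [ht.2])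
  have e : h * ((t - a) / h) + a = t := by field_simp; ring
  have e1 := key hC ((le_max_left _ _).trans (le_max_right _ _)) rfl hy H _ hu0 hu1
  have e2 := key hC' ((le_max_right _ _).trans (le_max_right _ _)) h0.symm hy' H' _ hu0 hu1
  rw [e] at e1 e2
  rw [e1, e2]

end LocalFlow

/-! ### Chain rule and gluing for Young equations -/

section Germ

namespace HasYoungGerm

variable {α a b : ℝ}

/-- The chain rule: Young integrals obey the rules of ordinary calculus, because the second order
Taylor remainder of a Hölder path is of order `2 * α > 1`. -/
lemma comp_contDiff {A : Type*} [NormedAddCommGroup A] [NormedSpace ℝ A] {E F : Type}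
    [NormedAddCommGroup E] [NormedSpace ℝ E] [ProperSpace E] [NormedAddCommGroup F]
    [NormedSpace ℝ F] {G : ℝ → A →L[ℝ] E} {Z : ℝ → A} {y : ℝ → E} {CZ : ℝ} (hα : 0 ≤ α)
    (h : HasYoungGerm α a b G Z y)
    (hG : ContinuousOn G (Icc a b)) (hy : ContinuousOn y (Icc a b))
    (hZ : ∀ s t, a ≤ s → s ≤ t → t ≤ b → ‖Z t - Z s‖ ≤ CZ * (t - s) ^ α) {g : E → F}
    (hg : ContDiff ℝ 2 g) :
    HasYoungGerm α a b (fun t => (fderiv ℝ g (y t)).comp (G t)) Z (fun t => g (y t)) := by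
  obtain ⟨B, hB⟩ := isCompact_Icc.exists_bound_of_continuousOn hG
  obtain ⟨R, hR⟩ := isCompact_Icc.exists_bound_of_continuousOn hy
  obtain ⟨C₁, hC₁, H₁⟩ := h.norm_sub_le hα (le_max_right B 0)
    (fun t ht => (hB t ht).trans (le_max_left _ _)) hZ
  obtain ⟨C, hC, H⟩ := h
  obtain ⟨L, hL, -, HL⟩ := exists_taylor_bound hg R
  obtain ⟨D, hD, HD, -⟩ := exists_lipschitz_bound (hg.of_le one_le_two) R
  refine ⟨L * C₁ ^ 2 + D * C, by positivity, fun s t h1 h2 h3 => ?_⟩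
  have hs : s ∈ Icc a b := ⟨h1, h2.trans h3⟩
  have ht : t ∈ Icc a b := ⟨h1.trans h2, h3⟩
  have e1 := HL (y s) (y s) (y t) ‖y t - y s‖ (hR s hs) (hR s hs) (hR t ht)
    (by simp) le_rfl
  have e : g (y t) - g (y s) - ((fderiv ℝ g (y s)).comp (G s)) (Z t - Z s) =
      (g (y t) - g (y s) - fderiv ℝ g (y s) (y t - y s)) +
        fderiv ℝ g (y s) (y t - y s - G s (Z t - Z s)) := by
    rw [map_sub (fderiv ℝ g (y s)) (y t - y s), ContinuousLinearMap.comp_apply]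
    abel
  have hp : (t - s) ^ (2 * α) = ((t - s) ^ α) ^ 2 := by
    rw [two_mul, Real.rpow_add_of_nonneg (by linarith) hα hα, sq]
  rw [e]
  calc _ ≤ L * ‖y t - y s‖ * ‖y t - y s‖ + D * (C * (t - s) ^ (2 * α)) := by
        refine (norm_add_le _ _).trans (add_le_add e1 ?_)
        refine (ContinuousLinearMap.le_opNorm _ _).trans ?_
        exact mul_le_mul (HD _ (hR s hs)) (H s t h1 h2 h3) (norm_nonneg _) hD
    _ = L * ‖y t - y s‖ ^ 2 + D * (C * (t - s) ^ (2 * α)) := by ring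
    _ ≤ L * (C₁ * (t - s) ^ α) ^ 2 + D * (C * (t - s) ^ (2 * α)) := by
        gcongr
        exact H₁ s t h1 h2 h3
    _ = _ := by rw [hp]; ring

variable {A F : Type*} [NormedAddCommGroup A] [NormedSpace ℝ A] [NormedAddCommGroup F]
  [NormedSpace ℝ F] {G : ℝ → A →L[ℝ] F} {Z : ℝ → A} {J : ℝ → F} {CZ CG : ℝ}

lemma concat {c : ℝ} (h : HasYoungGerm α a b G Z J) (h' : HasYoungGerm α b c G Z J)
    (hα : 0 < α) (hCG : 0 ≤ CG) (hCZ : 0 ≤ CZ)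
    (hG : ∀ s t, a ≤ s → s ≤ t → t ≤ b → ‖G t - G s‖ ≤ CG * (t - s) ^ α)
    (hZ : ∀ s t, ‖Z t - Z s‖ ≤ CZ * |t - s| ^ α) : HasYoungGerm α a c G Z J := by
  obtain ⟨C, hC, H⟩ := h
  obtain ⟨C', hC', H'⟩ := h'
  refine ⟨C + C' + CG * CZ, by positivity, fun s t h1 h2 h3 => ?_⟩
  have hp0 : 0 ≤ (t - s) ^ (2 * α) := Real.rpow_nonneg (by linarith) _
  have hCC : 0 ≤ CG * CZ := mul_nonneg hCG hCZ
  rcases le_total t b with htb | htb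
  · refine (H s t h1 h2 htb).trans ?_
    gcongr
    linarith
  rcases le_total b s with hbs | hbs
  · refine (H' s t hbs h2 h3).trans ?_
    gcongr
    linarith
  have e : J t - J s - G s (Z t - Z s) = (J b - J s - G s (Z b - Z s)) +
      (J t - J b - G b (Z t - Z b)) + (G b - G s) (Z t - Z b) := by
    simp only [map_sub, _root_.sub_apply]
    abel
  have e1 := hG s b h1 hbs le_rfl
  have e2 := hZ b t
  rw [abs_of_nonneg (by linarith)] at e2
  rw [e]
  calc _ ≤ C * (b - s) ^ (2 * α) + C' * (t - b) ^ (2 * α)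
        + (CG * (b - s) ^ α) * (CZ * (t - b) ^ α) := by
        refine (norm_add_le _ _).trans (add_le_add ((norm_add_le _ _).trans
          (add_le_add (H s b h1 hbs le_rfl) (H' b t le_rfl htb h3))) ?_)
        refine (ContinuousLinearMap.le_opNorm _ _).trans ?_
        exact mul_le_mul e1 e2 (norm_nonneg _) ((norm_nonneg _).trans e1)
    _ = C * (b - s) ^ (2 * α) + C' * (t - b) ^ (2 * α)
        + CG * CZ * ((b - s) ^ α * (t - b) ^ α) := by ring
    _ ≤ C * (t - s) ^ (2 * α) + C' * (t - s) ^ (2 * α) + CG * CZ * (t - s) ^ (2 * α) := by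
        have hm : (b - s) ^ α * (t - b) ^ α ≤ (t - s) ^ (2 * α) := by
          rw [two_mul]
          exact rpow_mul_rpow_le (by linarith) (by linarith) (by linarith) (by linarith)
            hα.le hα.le (by linarith)
        have := sub_nonneg.2 hbs
        have := sub_nonneg.2 htb
        gcongr
    _ = _ := by ring

/-- Reversal of time. -/
lemma comp_neg (h : HasYoungGerm α a b G Z J) (hα : 0 < α) (hCG : 0 ≤ CG) (hCZ : 0 ≤ CZ)
    (hG : ∀ s t, a ≤ s → s ≤ t → t ≤ b → ‖G t - G s‖ ≤ CG * (t - s) ^ α)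
    (hZ : ∀ s t, ‖Z t - Z s‖ ≤ CZ * |t - s| ^ α) :
    HasYoungGerm α (-b) (-a) (fun t => G (-t)) (fun t => Z (-t)) (fun t => J (-t)) := by
  obtain ⟨C, hC, H⟩ := h
  refine ⟨C + CG * CZ, by positivity, fun s t h1 h2 h3 => ?_⟩
  have e : J (-t) - J (-s) - G (-s) (Z (-t) - Z (-s)) =
      -(J (-s) - J (-t) - G (-t) (Z (-s) - Z (-t))) +
        (G (-s) - G (-t)) (Z (-s) - Z (-t)) := by
    simp only [map_sub, _root_.sub_apply]
    abel
  have e0 := H (-t) (-s) (by linarith) (by linarith) (by linarith)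
  have e1 := hG (-t) (-s) (by linarith) (by linarith) (by linarith)
  have e2 := hZ (-t) (-s)
  have hts : -s - -t = t - s := by ring
  rw [hts] at e0 e1 e2
  rw [abs_of_nonneg (by linarith)] at e2
  have hp : (t - s) ^ (2 * α) = (t - s) ^ α * (t - s) ^ α := by
    rw [two_mul, Real.rpow_add_of_nonneg (by linarith) hα.le hα.le]
  beta_reduce
  rw [e]
  calc _ ≤ C * (t - s) ^ (2 * α) + (CG * (t - s) ^ α) * (CZ * (t - s) ^ α) := by
        refine (norm_add_le _ _).trans (add_le_add (by rwa [norm_neg]) ?_)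
        refine (ContinuousLinearMap.le_opNorm _ _).trans ?_
        exact mul_le_mul e1 e2 (norm_nonneg _) ((norm_nonneg _).trans e1)
    _ = _ := by rw [hp]; ring

end HasYoungGerm

lemma norm_le_sum_coord {n : ℕ} (v : EuclideanSpace ℝ (Fin n)) : ‖v‖ ≤ ∑ i, ‖v i‖ := by
  have h := (EuclideanSpace.basisFun (Fin n) ℝ).sum_repr v
  calc ‖v‖ = ‖∑ i, v i • (EuclideanSpace.basisFun (Fin n) ℝ) i‖ := by
        conv_lhs => rw [← h]
        simp
    _ ≤ ∑ i, ‖v i • (EuclideanSpace.basisFun (Fin n) ℝ) i‖ := norm_sum_le _ _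
    _ = _ := by simp [norm_smul]

lemma opNorm_le_sum_basis {d : ℕ} {F : Type*} [NormedAddCommGroup F] [NormedSpace ℝ F]
    (T : EuclideanSpace ℝ (Fin d) →L[ℝ] F) :
    ‖T‖ ≤ ∑ i, ‖T (EuclideanSpace.basisFun (Fin d) ℝ i)‖ := by
  refine T.opNorm_le_bound (Finset.sum_nonneg fun _ _ => norm_nonneg _) fun v => ?_
  have h := (EuclideanSpace.basisFun (Fin d) ℝ).sum_repr v
  calc ‖T v‖ = ‖∑ i, v i • T (EuclideanSpace.basisFun (Fin d) ℝ i)‖ := by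
        conv_lhs => rw [← h]
        simp
    _ ≤ ∑ i, ‖v i • T (EuclideanSpace.basisFun (Fin d) ℝ i)‖ := norm_sum_le _ _
    _ ≤ ∑ i, ‖T (EuclideanSpace.basisFun (Fin d) ℝ i)‖ * ‖v‖ := by
        refine Finset.sum_le_sum fun i _ => ?_
        rw [norm_smul, mul_comm]
        gcongr
        exact PiLp.norm_apply_le v i
    _ = _ := by rw [Finset.sum_mul]

lemma HasYoungGerm.of_coord {n : ℕ} {A : Type*} [NormedAddCommGroup A] [NormedSpace ℝ A]
    {α a b : ℝ} {G : ℝ → A →L[ℝ] EuclideanSpace ℝ (Fin n)} {Z : ℝ → A}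
    {J : ℝ → EuclideanSpace ℝ (Fin n)}
    (h : ∀ i, HasYoungGerm α a b (fun t => (EuclideanSpace.proj i).comp (G t)) Z
      (fun t => J t i)) : HasYoungGerm α a b G Z J := by
  choose C hC H using h
  refine ⟨∑ i, C i, Finset.sum_nonneg fun i _ => hC i, fun s t h1 h2 h3 => ?_⟩
  refine (norm_le_sum_coord _).trans ?_
  rw [Finset.sum_mul]
  exact Finset.sum_le_sum fun i _ => H i s t h1 h2 h3

end Germ

/-! ### The equation in a chart -/

section Chart

variable {n d : ℕ} {M : Type*} [TopologicalSpace M] [ChartedSpace (EuclideanSpace ℝ (Fin n)) M]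
  {E' : Type*} [NormedAddCommGroup E'] [NormedSpace ℝ E']
  {X : ∀ p : M, EuclideanSpace ℝ (Fin d) →L[ℝ] TangentSpace (𝓡 n) p}

/-- The derivative of a vector valued function along the vector fields `X`. -/
noncomputable def vectorFieldDeriv
    (X : ∀ p : M, EuclideanSpace ℝ (Fin d) →L[ℝ] TangentSpace (𝓡 n) p) (f : M → E') (p : M) :
    EuclideanSpace ℝ (Fin d) →L[ℝ] E' :=
  (mfderiv (𝓡 n) 𝓘(ℝ, E') f p).comp (X p)

lemma contMDiff_vectorFieldDeriv_apply [IsManifold (𝓡 n) ∞ M] (hX : SmoothFields X) {f : M → E'}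
    (hf : ContMDiff (𝓡 n) 𝓘(ℝ, E') ∞ f) (v : EuclideanSpace ℝ (Fin d)) :
    ContMDiff (𝓡 n) 𝓘(ℝ, E') ∞ (fun p => vectorFieldDeriv X f p v) :=
  (contMDiff_snd_tangentBundle_modelSpace E' 𝓘(ℝ, E')).comp
    ((hf.contMDiff_tangentMap (m := ∞) le_rfl).comp (hX v))

/-- The chain rule for a function of a vector valued function. -/
lemma vectorFieldDeriv_comp {E'' : Type*} [NormedAddCommGroup E''] [NormedSpace ℝ E'']
    {F : M → E'} {g : E' → E''} {p : M}
    (hF : MDifferentiableAt (𝓡 n) 𝓘(ℝ, E') F p) (hg : DifferentiableAt ℝ g (F p)) :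
    vectorFieldDeriv X (fun q => g (F q)) p = (fderiv ℝ g (F p)).comp (vectorFieldDeriv X F p) := by
  have h := mfderiv_comp (I := 𝓡 n) (I' := 𝓘(ℝ, E')) (I'' := 𝓘(ℝ, E'')) p
    hg.mdifferentiableAt hF
  unfold vectorFieldDeriv
  change (mfderiv (𝓡 n) 𝓘(ℝ, E'') (g ∘ F) p).comp (X p) = _
  rw [h, mfderiv_eq_fderiv]
  rfl

lemma vectorFieldDeriv_congr {f g : M → E'} {p : M} (h : f =ᶠ[𝓝 p] g) :
    vectorFieldDeriv X f p = vectorFieldDeriv X g p := by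
  unfold vectorFieldDeriv
  rw [h.mfderiv_eq]
  rfl

variable [IsManifold (𝓡 n) ∞ M]

/-- A smooth function on the manifold, read in a chart and cut off, is a smooth function on the
model space. -/
lemma contDiff_bump_smul_comp_symm {p₀ : M} (χ : SmoothBumpFunction (𝓡 n) p₀) {h : M → E'}
    (hh : ContMDiff (𝓡 n) 𝓘(ℝ, E') ∞ h) :
    ContDiff ℝ ∞ (fun y => χ.toContDiffBump y • h ((extChartAt (𝓡 n) p₀).symm y)) := by
  refine contDiff_iff_contDiffAt.2 fun y => ?_
  by_cases hy : y ∈ tsupport χ.toContDiffBump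
  · have hyt : y ∈ (extChartAt (𝓡 n) p₀).target := by
      rw [χ.toContDiffBump.tsupport_eq] at hy
      exact χ.closedBall_subset ⟨hy, by simp⟩
    have h1 : ContMDiffAt 𝓘(ℝ, EuclideanSpace ℝ (Fin n)) 𝓘(ℝ, E') ∞
        (fun y => h ((extChartAt (𝓡 n) p₀).symm y)) y :=
      hh.contMDiffAt.comp y (((contMDiffOn_extChartAt_symm p₀) y hyt).contMDiffAt
        ((isOpen_extChartAt_target p₀).mem_nhds hyt))
    exact χ.toContDiffBump.contDiffAt.smul (contMDiffAt_iff_contDiffAt.1 h1)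
  · refine (contDiffAt_const (c := (0 : E'))).congr_of_eventuallyEq ?_
    filter_upwards [notMem_tsupport_iff_eventuallyEq.1 hy] with z hz
    rw [hz, Pi.zero_apply, zero_smul]

variable [T2Space M]

/-- The equation in a chart around `p₀`: near `p₀`, the vector fields `X` are given by smooth
vector fields `V` on the model space, the chart `κ` agrees with a globally defined smooth function
`F`, and a smooth function `f` on the manifold agrees, in the chart, with a smooth function on the
model space. -/
lemma exists_chart_equation (hX : SmoothFields X) (p₀ : M) :
    ∃ (V : EuclideanSpace ℝ (Fin n) → EuclideanSpace ℝ (Fin d) →L[ℝ] EuclideanSpace ℝ (Fin n))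
      (F : M → EuclideanSpace ℝ (Fin n)) (r : ℝ), ContDiff ℝ ∞ V ∧
      ContMDiff (𝓡 n) 𝓘(ℝ, EuclideanSpace ℝ (Fin n)) ∞ F ∧ 0 < r ∧
      Metric.ball (extChartAt (𝓡 n) p₀ p₀) r ⊆ (extChartAt (𝓡 n) p₀).target ∧
      (∀ x ∈ (extChartAt (𝓡 n) p₀).source,
        extChartAt (𝓡 n) p₀ x ∈ Metric.ball (extChartAt (𝓡 n) p₀ p₀) r →
        F x = extChartAt (𝓡 n) p₀ x ∧ vectorFieldDeriv X F x = V (extChartAt (𝓡 n) p₀ x)) ∧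
      ∀ f : M → ℝ, ContMDiff (𝓡 n) 𝓘(ℝ, ℝ) ∞ f → ∃ g : EuclideanSpace ℝ (Fin n) → ℝ,
        ContDiff ℝ ∞ g ∧ ∀ y ∈ Metric.ball (extChartAt (𝓡 n) p₀ p₀) r,
          f ((extChartAt (𝓡 n) p₀).symm y) = g y ∧
          fieldDeriv X f ((extChartAt (𝓡 n) p₀).symm y) = (fderiv ℝ g y).comp (V y) := by
  obtain ⟨χ⟩ : Nonempty (SmoothBumpFunction (𝓡 n) p₀) := inferInstance
  set κ := extChartAt (𝓡 n) p₀ with hκ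
  let F : M → EuclideanSpace ℝ (Fin n) := fun x => χ x • κ x
  have hF : ContMDiff (𝓡 n) 𝓘(ℝ, EuclideanSpace ℝ (Fin n)) ∞ F :=
    χ.contMDiff_smul contMDiffOn_extChartAt
  have hball : Metric.ball (κ p₀) χ.rIn ⊆ κ.target := by
    refine fun y hy => χ.ball_subset ⟨?_, by simp⟩
    exact Metric.ball_subset_ball χ.rIn_lt_rOut.le hy
  have hFκ : ∀ x ∈ κ.source, κ x ∈ Metric.ball (κ p₀) χ.rIn → F =ᶠ[𝓝 x] κ := by
    intro x hx hxr
    have hx' : x ∈ (chartAt (EuclideanSpace ℝ (Fin n)) p₀).source := by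
      rwa [hκ, extChartAt_source] at hx
    filter_upwards [χ.eventuallyEq_one_of_dist_lt hx' hxr] with z hz
    simp only [F]
    rw [hz, Pi.one_apply, one_smul]
  have hone : ∀ y ∈ Metric.ball (κ p₀) χ.rIn, χ.toContDiffBump y = 1 := fun y hy =>
    χ.toContDiffBump.one_of_mem_closedBall (Metric.ball_subset_closedBall hy)
  let V : EuclideanSpace ℝ (Fin n) → EuclideanSpace ℝ (Fin d) →L[ℝ] EuclideanSpace ℝ (Fin n) :=
    fun y => χ.toContDiffBump y • vectorFieldDeriv X F (κ.symm y)
  have hV : ContDiff ℝ ∞ V := by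
    refine contDiff_clm_apply_iff.2 fun v => ?_
    exact contDiff_bump_smul_comp_symm χ (contMDiff_vectorFieldDeriv_apply hX hF v)
  refine ⟨V, F, χ.rIn, hV, hF, χ.rIn_pos, hball, fun x hx hxr => ⟨?_, ?_⟩, fun f hf => ?_⟩
  · exact (hFκ x hx hxr).self_of_nhds
  · simp only [V]
    rw [hone _ hxr, one_smul, κ.left_inv hx]
  · refine ⟨_, contDiff_bump_smul_comp_symm χ hf, fun y hy => ⟨?_, ?_⟩⟩
    · rw [hone y hy, one_smul]
    · have hyt := hball hy
      have hxs : κ.symm y ∈ κ.source := κ.map_target hyt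
      have hκy : κ (κ.symm y) = y := κ.right_inv hyt
      have hFx := hFκ _ hxs (by rwa [hκy])
      have hFy : F (κ.symm y) = y := hFx.self_of_nhds.trans hκy
      have hg := contDiff_bump_smul_comp_symm χ hf
      have heq : f =ᶠ[𝓝 (κ.symm y)]
          fun q => (fun y => χ.toContDiffBump y • f (κ.symm y)) (F q) := by
        have hcont : ContinuousAt κ (κ.symm y) := continuousAt_extChartAt' hxs
        have hmem : ∀ᶠ q in 𝓝 (κ.symm y), κ q ∈ Metric.ball (κ p₀) χ.rIn :=
          hcont.eventually (Metric.isOpen_ball.mem_nhds (by rwa [hκy]))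
        have hsrc : ∀ᶠ q in 𝓝 (κ.symm y), q ∈ κ.source :=
          (isOpen_extChartAt_source p₀).mem_nhds hxs
        filter_upwards [hFx, hmem, hsrc] with q h1 h2 h3
        beta_reduce
        rw [h1, hone _ h2, one_smul, κ.left_inv h3]
      change vectorFieldDeriv X f (κ.symm y) = _
      rw [vectorFieldDeriv_congr heq, vectorFieldDeriv_comp
        (hF.mdifferentiable (by simp) _) (hg.differentiable (by simp) _), hFy]
      simp only [V]
      rw [hone y hy, one_smul]

end Chart

/-! ### Solutions on compact intervals -/

section PathSolution

variable {n d : ℕ} {M : Type*} [TopologicalSpace M] [ChartedSpace (EuclideanSpace ℝ (Fin n)) M]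
  {X : ∀ p : M, EuclideanSpace ℝ (Fin d) →L[ℝ] TangentSpace (𝓡 n) p}
  {α CZ a b c : ℝ} {Z : ℝ → EuclideanSpace ℝ (Fin d)} {x x' : ℝ → M}

/-- The local form of the equation on a compact interval: the increments of `f (x t)` are those of
`Xf(x) dZ` up to an error of order `2 * α > 1`. -/
def IsPathSolution (α : ℝ) (X : ∀ p : M, EuclideanSpace ℝ (Fin d) →L[ℝ] TangentSpace (𝓡 n) p)
    (Z : ℝ → EuclideanSpace ℝ (Fin d)) (a b : ℝ) (x : ℝ → M) : Prop :=
  ContinuousOn x (Icc a b) ∧ ∀ f : M → ℝ, ContMDiff (𝓡 n) 𝓘(ℝ, ℝ) ∞ f →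
    HasYoungGerm α a b (fun t => fieldDeriv X f (x t)) Z (fun t => f (x t))

namespace IsPathSolution

lemma mono {a' b' : ℝ} (h : IsPathSolution α X Z a b x) (ha : a ≤ a') (hb : b' ≤ b) :
    IsPathSolution α X Z a' b' x :=
  ⟨h.1.mono (Icc_subset_Icc ha hb), fun f hf => (h.2 f hf).mono ha hb⟩

lemma congr (h : IsPathSolution α X Z a b x) (hx : EqOn x' x (Icc a b)) :
    IsPathSolution α X Z a b x' :=
  ⟨h.1.congr hx, fun f hf => (h.2 f hf).congr (fun t ht => by rw [hx ht]) (fun _ _ => rfl)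
    fun t ht => by rw [hx ht]⟩

lemma refl (α : ℝ) (X : ∀ p : M, EuclideanSpace ℝ (Fin d) →L[ℝ] TangentSpace (𝓡 n) p)
    (Z : ℝ → EuclideanSpace ℝ (Fin d)) (a : ℝ) (x : ℝ → M) : IsPathSolution α X Z a a x := by
  refine ⟨by rw [Icc_self]; exact continuousOn_singleton _ _, fun f _ =>
    ⟨0, le_rfl, fun s t h1 h2 h3 => ?_⟩⟩
  obtain rfl : s = t := le_antisymm h2 (h3.trans h1)
  simp

variable [IsManifold (𝓡 n) ∞ M]

lemma continuous_fieldDeriv (hX : SmoothFields X) {f : M → ℝ}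
    (hf : ContMDiff (𝓡 n) 𝓘(ℝ, ℝ) ∞ f) : Continuous (fun p => fieldDeriv X f p) :=
  continuous_clm_apply.2 fun v => (contMDiff_vectorFieldDeriv_apply hX hf v).continuous

lemma norm_sub_le (h : IsPathSolution α X Z a b x) (hX : SmoothFields X) (hα : 0 < α)
    (hZ : ∀ s t, ‖Z t - Z s‖ ≤ CZ * |t - s| ^ α) {f : M → ℝ}
    (hf : ContMDiff (𝓡 n) 𝓘(ℝ, ℝ) ∞ f) :
    ∃ C, 0 ≤ C ∧ ∀ s t, a ≤ s → s ≤ t → t ≤ b → ‖f (x t) - f (x s)‖ ≤ C * (t - s) ^ α := by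
  obtain ⟨B, hB⟩ := isCompact_Icc.exists_bound_of_continuousOn
    ((continuous_fieldDeriv hX hf).comp_continuousOn h.1)
  refine (h.2 f hf).norm_sub_le (CZ := CZ) hα.le (le_max_right B 0)
    (fun t ht => (hB t ht).trans (le_max_left _ _)) fun s t _ hst _ => ?_
  have := hZ s t
  rwa [abs_of_nonneg (sub_nonneg.2 hst)] at this

lemma fieldDeriv_norm_sub_le (h : IsPathSolution α X Z a b x) (hX : SmoothFields X) (hα : 0 < α)
    (hZ : ∀ s t, ‖Z t - Z s‖ ≤ CZ * |t - s| ^ α) {f : M → ℝ}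
    (hf : ContMDiff (𝓡 n) 𝓘(ℝ, ℝ) ∞ f) :
    ∃ C, 0 ≤ C ∧ ∀ s t, a ≤ s → s ≤ t → t ≤ b →
      ‖fieldDeriv X f (x t) - fieldDeriv X f (x s)‖ ≤ C * (t - s) ^ α := by
  choose C hC H using fun i => h.norm_sub_le hX hα hZ
    (contMDiff_vectorFieldDeriv_apply hX hf (EuclideanSpace.basisFun (Fin d) ℝ i))
  refine ⟨∑ i, C i, Finset.sum_nonneg fun i _ => hC i, fun s t h1 h2 h3 => ?_⟩
  refine (opNorm_le_sum_basis _).trans ?_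
  rw [Finset.sum_mul]
  exact Finset.sum_le_sum fun i _ => H i s t h1 h2 h3

lemma concat (hX : SmoothFields X) (hα : 0 < α) (hCZ : 0 ≤ CZ)
    (hZ : ∀ s t, ‖Z t - Z s‖ ≤ CZ * |t - s| ^ α) (hab : a ≤ b) (hbc : b ≤ c)
    (h : IsPathSolution α X Z a b x) (h' : IsPathSolution α X Z b c x) :
    IsPathSolution α X Z a c x := by
  refine ⟨?_, fun f hf => ?_⟩
  · rw [← Icc_union_Icc_eq_Icc hab hbc]
    exact h.1.union_of_isClosed h'.1 isClosed_Icc isClosed_Icc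
  · obtain ⟨CG, hCG, HG⟩ := h.fieldDeriv_norm_sub_le hX hα hZ hf
    exact (h.2 f hf).concat (h'.2 f hf) hα hCG hCZ HG hZ

lemma glue (hX : SmoothFields X) (hα : 0 < α) (hCZ : 0 ≤ CZ)
    (hZ : ∀ s t, ‖Z t - Z s‖ ≤ CZ * |t - s| ^ α) (hab : a ≤ b) (hbc : b ≤ c)
    (h : IsPathSolution α X Z a b x) (h' : IsPathSolution α X Z b c x') (hb : x b = x' b) :
    IsPathSolution α X Z a c (fun t => if t ≤ b then x t else x' t) := by
  refine concat hX hα hCZ hZ hab hbc (h.congr fun t ht => if_pos ht.2) (h'.congr fun t ht => ?_)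
  rcases ht.1.eq_or_lt with rfl | hlt
  · simp [hb]
  · simp [not_le.2 hlt]

lemma comp_neg (hX : SmoothFields X) (hα : 0 < α) (hCZ : 0 ≤ CZ)
    (hZ : ∀ s t, ‖Z t - Z s‖ ≤ CZ * |t - s| ^ α) (h : IsPathSolution α X Z a b x) :
    IsPathSolution α X (fun t => Z (-t)) (-b) (-a) (fun t => x (-t)) := by
  refine ⟨h.1.comp continuous_neg.continuousOn fun t ht => ?_, fun f hf => ?_⟩
  · exact ⟨by linarith [ht.2], by linarith [ht.1]⟩
  · obtain ⟨CG, hCG, HG⟩ := h.fieldDeriv_norm_sub_le hX hα hZ hf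
    exact (h.2 f hf).comp_neg hα hCG hCZ HG hZ

/-! ### Uniqueness -/

variable [T2Space M]

/-- Two solutions which agree at a time agree for a short time afterwards. -/
lemma exists_eq_after (hX : SmoothFields X) (hα : 1 / 2 < α) (hCZ : 0 ≤ CZ)
    (hZ : ∀ s t, ‖Z t - Z s‖ ≤ CZ * |t - s| ^ α) (hab : a < b)
    (h : IsPathSolution α X Z a b x) (h' : IsPathSolution α X Z a b x') (h0 : x a = x' a) :
    ∃ h, 0 < h ∧ a + h ≤ b ∧ EqOn x x' (Icc a (a + h)) := by
  obtain ⟨V, F, r, hV, hF, hr, -, hchart, -⟩ := exists_chart_equation hX (x a)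
  set κ := extChartAt (𝓡 n) (x a) with hκ
  let N : Set M := κ.source ∩ κ ⁻¹' Metric.ball (κ (x a)) r
  have hN : N ∈ 𝓝 (x a) := inter_mem (extChartAt_source_mem_nhds (x a))
    ((continuousAt_extChartAt (x a)).preimage_mem_nhds (Metric.ball_mem_nhds _ hr))
  have hev : ∀ {z : ℝ → M}, IsPathSolution α X Z a b z → z a = x a →
      ∀ᶠ t in 𝓝[≥] a, z t ∈ N := by
    intro z hz hza
    have h1 := hz.1 a (left_mem_Icc.2 hab.le)
    rw [ContinuousWithinAt, nhdsWithin_Icc_eq_nhdsGE hab, hza] at h1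
    exact h1 hN
  obtain ⟨c, hc, hcN⟩ : ∃ c ∈ Ioc a b, ∀ t ∈ Icc a c, x t ∈ N ∧ x' t ∈ N := by
    have h1 := (hev h rfl).and (hev h' h0.symm)
    obtain ⟨u, hu, hu'⟩ := mem_nhdsGE_iff_exists_Icc_subset.1 h1
    refine ⟨min u b, ⟨lt_min hu hab, min_le_right _ _⟩, fun t ht => hu' ⟨ht.1, ?_⟩⟩
    exact ht.2.trans (min_le_left _ _)
  have key : ∀ {z : ℝ → M}, IsPathSolution α X Z a b z → (∀ t ∈ Icc a c, z t ∈ N) →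
      ContinuousOn (fun t => κ (z t)) (Icc a c) ∧
      HasYoungGerm α a c (fun t => V (κ (z t))) Z (fun t => κ (z t)) := by
    intro z hz hzN
    have hz' := hz.mono le_rfl hc.2
    refine ⟨(continuousOn_extChartAt (x a)).comp hz'.1 fun t ht => (hzN t ht).1, ?_⟩
    refine HasYoungGerm.of_coord fun i => ?_
    have hsm : ContMDiff (𝓡 n) 𝓘(ℝ, ℝ) ∞ (fun q => EuclideanSpace.proj (𝕜 := ℝ) i (F q)) :=
      (EuclideanSpace.proj (𝕜 := ℝ) i : EuclideanSpace ℝ (Fin n) →L[ℝ] ℝ).contDiff.contMDiff.comp hF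
    refine (hz'.2 _ hsm).congr (fun t ht => ?_) (fun _ _ => rfl) fun t ht => ?_
    · have hN := hzN t ht
      beta_reduce
      rw [← (hchart _ hN.1 hN.2).2]
      change _ = vectorFieldDeriv X _ (z t)
      rw [vectorFieldDeriv_comp (g := (EuclideanSpace.proj (𝕜 := ℝ) i))
        (hF.mdifferentiable (by simp) _) (ContinuousLinearMap.differentiableAt _),
        ContinuousLinearMap.fderiv]
    · have hN := hzN t ht
      beta_reduce
      rw [(hchart _ hN.1 hN.2).1]
      rfl
  have k := key h fun t ht => (hcN t ht).1
  have k' := key h' fun t ht => (hcN t ht).2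
  obtain ⟨δ, hδ, hδc, heq⟩ := eqOn_short_of_hasYoungGerm hα hV hCZ hZ hc.1 k.1 k'.1
    (by rw [h0]) k.2 k'.2
  refine ⟨δ, hδ, hδc.trans hc.2, fun t ht => ?_⟩
  have ht' : t ∈ Icc a c := ⟨ht.1, ht.2.trans hδc⟩
  exact κ.injOn (hcN t ht').1.1 (hcN t ht').2.1 (heq ht)

theorem eqOn (hX : SmoothFields X) (hα : 1 / 2 < α) (hCZ : 0 ≤ CZ)
    (hZ : ∀ s t, ‖Z t - Z s‖ ≤ CZ * |t - s| ^ α)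
    (h : IsPathSolution α X Z a b x) (h' : IsPathSolution α X Z a b x') (h0 : x a = x' a) :
    EqOn x x' (Icc a b) := by
  have hclosed : IsClosed ({t | x t = x' t} ∩ Icc a b) := by
    have := (h.1.prodMk h'.1).preimage_isClosed_of_isClosed isClosed_Icc isClosed_diagonal
    rwa [inter_comm] at this
  refine hclosed.Icc_subset_of_forall_exists_gt h0 fun t ht u hu => ?_
  obtain ⟨δ, hδ, -, heq⟩ := exists_eq_after hX hα hCZ hZ ht.2.2 (h.mono ht.2.1 le_rfl)
    (h'.mono ht.2.1 le_rfl) ht.1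
  have hlt : t < min u (t + δ) := lt_min hu (by linarith)
  exact ⟨min u (t + δ), heq ⟨hlt.le, min_le_right _ _⟩, hlt, min_le_left _ _⟩

end IsPathSolution

/-! ### Local flows on the manifold -/

variable [IsManifold (𝓡 n) ∞ M] [T2Space M]

theorem exists_local_flow_manifold (hX : SmoothFields X) (hα : 1 / 2 < α) (hCZ : 0 ≤ CZ)
    (hZ : ∀ s t, ‖Z t - Z s‖ ≤ CZ * |t - s| ^ α) (p₀ : M) :
    ∃ U : Set M, IsOpen U ∧ p₀ ∈ U ∧ ∃ δ > 0, ∃ Φ : ℝ → M → ℝ → M, ∀ a : ℝ,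
      (∀ p ∈ U, Φ a p a = p ∧ IsPathSolution α X Z a (a + δ) (Φ a p)) ∧
      (∀ t, ContMDiffOn (𝓡 n) (𝓡 n) ∞ (fun p => Φ a p t) U) ∧
      ContinuousOn (fun q : ℝ × M => Φ a q.2 q.1) (univ ×ˢ U) := by
  obtain ⟨V, F, r, hV, -, hr, hball, -, hfun⟩ := exists_chart_equation hX p₀
  set κ := extChartAt (𝓡 n) p₀ with hκ
  obtain ⟨ρ, hρ, δ, hδ, y, hy⟩ := exists_local_flow hα hV hCZ hZ (κ p₀) hr
  let U : Set M := κ.source ∩ κ ⁻¹' Metric.ball (κ p₀) ρ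
  have hκc : ContinuousOn κ κ.source := continuousOn_extChartAt p₀
  have hκs : ContinuousOn κ.symm κ.target := continuousOn_extChartAt_symm p₀
  refine ⟨U, hκc.isOpen_inter_preimage (isOpen_extChartAt_source p₀) Metric.isOpen_ball,
    ⟨mem_extChartAt_source p₀, Metric.mem_ball_self hρ⟩, δ, hδ,
    fun a p t => κ.symm (y a (κ p) t), fun a => ⟨fun p hp => ?_, fun t => ?_, ?_⟩⟩
  · obtain ⟨h0, hc, hg, hmem⟩ := (hy a).1 (κ p) hp.2
    refine ⟨by beta_reduce; rw [h0, κ.left_inv hp.1], ?_, fun f hf => ?_⟩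
    · exact (hκs.comp_continuous hc fun t => hball (hmem t)).continuousOn
    · obtain ⟨g, hg', hfg⟩ := hfun f hf
      have := hg.comp_contDiff (CZ := CZ) (by linarith)
        (hV.continuous.comp hc).continuousOn hc.continuousOn (fun s t _ hst _ => by
          have := hZ s t
          rwa [abs_of_nonneg (sub_nonneg.2 hst)] at this) (contDiff_infty.1 hg' 2)
      exact this.congr (fun t _ => (hfg _ (hmem t)).2) (fun _ _ => rfl) fun t _ => (hfg _ (hmem t)).1
  · have h1 : ContMDiffOn (𝓡 n) 𝓘(ℝ, EuclideanSpace ℝ (Fin n)) ∞ κ U := by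
      refine (contMDiffOn_extChartAt (I := 𝓡 n) (x := p₀)).mono fun p hp => ?_
      have := hp.1
      rwa [hκ, extChartAt_source] at this
    have h2 : ContMDiffOn (𝓡 n) 𝓘(ℝ, EuclideanSpace ℝ (Fin n)) ∞ (fun p => y a (κ p) t) U :=
      (contMDiffOn_iff_contDiffOn.2 ((hy a).2.1 t)).comp h1 fun p hp => hp.2
    exact (contMDiffOn_extChartAt_symm p₀).comp h2 fun p hp => hball (((hy a).1 _ hp.2).2.2.2 t)
  · refine hκs.comp ?_ fun q hq => hball (((hy a).1 _ hq.2.2).2.2.2 q.1)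
    refine (hy a).2.2.comp (f := fun q : ℝ × M => (q.1, κ q.2)) ?_ fun q hq => ⟨trivial, hq.2.2⟩
    exact continuousOn_fst.prodMk (hκc.comp continuousOn_snd fun q hq => hq.2.1)

end PathSolution

/-! ### The flow -/

section Flow

variable {n d : ℕ} {M : Type*} [TopologicalSpace M] [ChartedSpace (EuclideanSpace ℝ (Fin n)) M]
  {X : ∀ p : M, EuclideanSpace ℝ (Fin d) →L[ℝ] TangentSpace (𝓡 n) p}
  {α CZ s t u : ℝ} {Z : ℝ → EuclideanSpace ℝ (Fin d)} {x : ℝ → M} {p : M}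

/-- The set of the points whose solution started at time `s` exists up to time `t`. -/
def flowDomain (α : ℝ) (X : ∀ p : M, EuclideanSpace ℝ (Fin d) →L[ℝ] TangentSpace (𝓡 n) p)
    (Z : ℝ → EuclideanSpace ℝ (Fin d)) (s t : ℝ) : Set M :=
  {p | s ≤ t ∧ ∃ x, x s = p ∧ IsPathSolution α X Z s t x}

open Classical in
/-- The flow: the value at time `t` of the solution started from `p` at time `s`, and `p` itself
outside the domain of the flow. -/
noncomputable def flow (α : ℝ) (X : ∀ p : M, EuclideanSpace ℝ (Fin d) →L[ℝ] TangentSpace (𝓡 n) p)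
    (Z : ℝ → EuclideanSpace ℝ (Fin d)) (s t : ℝ) (p : M) : M :=
  if h : p ∈ flowDomain α X Z s t then h.2.choose t else p

lemma mem_flowDomain_self (p : M) (s : ℝ) : p ∈ flowDomain α X Z s s :=
  ⟨le_rfl, fun _ => p, rfl, IsPathSolution.refl α X Z s _⟩

lemma mem_flowDomain_of_le (h : p ∈ flowDomain α X Z s u) (hst : s ≤ t) (htu : t ≤ u) :
    p ∈ flowDomain α X Z s t := by
  obtain ⟨-, x, hx, hsol⟩ := h
  exact ⟨hst, x, hx, hsol.mono le_rfl htu⟩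

variable [IsManifold (𝓡 n) ∞ M]

/-- The standing assumptions on the equation: smooth vector fields, and a driver which is
`α`-Hölder on the line with `α > 1 / 2`. -/
structure IsYoungSystem (α CZ : ℝ)
    (X : ∀ p : M, EuclideanSpace ℝ (Fin d) →L[ℝ] TangentSpace (𝓡 n) p)
    (Z : ℝ → EuclideanSpace ℝ (Fin d)) : Prop where
  smooth : SmoothFields X
  lt : 1 / 2 < α
  nonneg : 0 ≤ CZ
  holder : ∀ s t, ‖Z t - Z s‖ ≤ CZ * |t - s| ^ α

lemma IsYoungSystem.pos (H : IsYoungSystem α CZ X Z) : 0 < α := by linarith [H.lt]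

lemma IsYoungSystem.neg (H : IsYoungSystem α CZ X Z) : IsYoungSystem α CZ X (fun t => Z (-t)) :=
  ⟨H.smooth, H.lt, H.nonneg, fun s t => by
    have := H.holder (-s) (-t)
    rwa [show -t - -s = -(t - s) by ring, abs_neg] at this⟩

variable [T2Space M] (H : IsYoungSystem α CZ X Z)
include H

lemma flow_eq (hst : s ≤ t) (hx : IsPathSolution α X Z s t x) (hp : x s = p) :
    flow α X Z s t p = x t := by
  have h : p ∈ flowDomain α X Z s t := ⟨hst, x, hp, hx⟩
  unfold flow
  rw [dif_pos h]
  obtain ⟨h1, h2⟩ := h.2.choose_spec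
  exact IsPathSolution.eqOn H.smooth H.lt H.nonneg H.holder h2 hx (h1.trans hp.symm)
    (right_mem_Icc.2 hst)

lemma flow_self (s : ℝ) (p : M) : flow α X Z s s p = p :=
  flow_eq H le_rfl (IsPathSolution.refl α X Z s fun _ => p) rfl

lemma isPathSolution_flow (h : p ∈ flowDomain α X Z s t) :
    IsPathSolution α X Z s t (fun r => flow α X Z s r p) := by
  obtain ⟨-, x, hx, hsol⟩ := h
  exact hsol.congr fun r hr => flow_eq H hr.1 (hsol.mono le_rfl hr.2) hx

/-- The flow property, with the matching of the domains. -/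
lemma flow_cocycle (htu : t ≤ u) (hp : p ∈ flowDomain α X Z s t) :
    (p ∈ flowDomain α X Z s u ↔ flow α X Z s t p ∈ flowDomain α X Z t u) ∧
      (p ∈ flowDomain α X Z s u → flow α X Z s u p = flow α X Z t u (flow α X Z s t p)) := by
  have hst := hp.1
  refine ⟨⟨fun h => ?_, fun h => ?_⟩, fun h => ?_⟩
  · exact ⟨htu, _, rfl, (isPathSolution_flow H h).mono hst le_rfl⟩
  · refine ⟨hst.trans htu, _, ?_, IsPathSolution.glue H.smooth H.pos H.nonneg H.holder hst htu
      (isPathSolution_flow H hp) (isPathSolution_flow H h) ?_⟩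
    · rw [if_pos hst, flow_self H]
    · rw [flow_self H]
  · exact (flow_eq H htu ((isPathSolution_flow H h).mono hst le_rfl) rfl).symm

/-! ### Openness of the domain, continuity and smoothness of the flow -/

lemma exists_flow_nhds (p₀ : M) : ∃ U : Set M, IsOpen U ∧ p₀ ∈ U ∧ ∃ δ > 0, ∀ a : ℝ,
    (∀ t ∈ Icc a (a + δ), U ⊆ flowDomain α X Z a t ∧
      ContMDiffOn (𝓡 n) (𝓡 n) ∞ (flow α X Z a t) U) ∧
    ContinuousOn (fun q : ℝ × M => flow α X Z a q.1 q.2) (Icc a (a + δ) ×ˢ U) := by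
  obtain ⟨U, hU, hpU, δ, hδ, Φ, hΦ⟩ :=
    exists_local_flow_manifold H.smooth H.lt H.nonneg H.holder p₀
  have heq : ∀ a, ∀ t ∈ Icc a (a + δ), ∀ p ∈ U, flow α X Z a t p = Φ a p t := fun a t ht p hp =>
    flow_eq H ht.1 (((hΦ a).1 p hp).2.mono le_rfl ht.2) ((hΦ a).1 p hp).1
  refine ⟨U, hU, hpU, δ, hδ, fun a => ⟨fun t ht => ⟨fun p hp => ?_, ?_⟩, ?_⟩⟩
  · exact ⟨ht.1, Φ a p, ((hΦ a).1 p hp).1, ((hΦ a).1 p hp).2.mono le_rfl ht.2⟩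
  · exact ((hΦ a).2.1 t).congr fun p hp => heq a t ht p hp
  · exact ((hΦ a).2.2.mono (prod_mono (subset_univ _) le_rfl)).congr fun q hq =>
      heq a q.1 hq.1 q.2 hq.2

/-- On a compact set the local flow exists for a uniform time. -/
lemma exists_uniform_flow_nhds {K : Set M} (hK : IsCompact K) : ∃ δ > 0, ∀ p₀ ∈ K,
    ∃ U : Set M, IsOpen U ∧ p₀ ∈ U ∧ ∀ a : ℝ,
    (∀ t ∈ Icc a (a + δ), U ⊆ flowDomain α X Z a t ∧
      ContMDiffOn (𝓡 n) (𝓡 n) ∞ (flow α X Z a t) U) ∧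
    ContinuousOn (fun q : ℝ × M => flow α X Z a q.1 q.2) (Icc a (a + δ) ×ˢ U) := by
  have hmono : ∀ {δ δ' : ℝ}, δ' ≤ δ → ∀ a : ℝ, Icc a (a + δ') ⊆ Icc a (a + δ) := fun h a =>
    Icc_subset_Icc_right (by linarith)
  refine hK.induction_on (p := fun S => ∃ δ > 0, ∀ p₀ ∈ S, ∃ U : Set M, IsOpen U ∧ p₀ ∈ U ∧
    ∀ a : ℝ, (∀ t ∈ Icc a (a + δ), U ⊆ flowDomain α X Z a t ∧
      ContMDiffOn (𝓡 n) (𝓡 n) ∞ (flow α X Z a t) U) ∧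
    ContinuousOn (fun q : ℝ × M => flow α X Z a q.1 q.2) (Icc a (a + δ) ×ˢ U)) ?_ ?_ ?_ ?_
  · exact ⟨1, one_pos, fun p hp => hp.elim⟩
  · rintro S T hST ⟨δ, hδ, h⟩
    exact ⟨δ, hδ, fun p hp => h p (hST hp)⟩
  · rintro S T ⟨δ, hδ, h⟩ ⟨δ', hδ', h'⟩
    refine ⟨min δ δ', lt_min hδ hδ', fun p hp => ?_⟩
    rcases hp with hp | hp
    · obtain ⟨U, hU, hpU, hloc⟩ := h p hp
      exact ⟨U, hU, hpU, fun a => ⟨fun t ht => (hloc a).1 t (hmono (min_le_left _ _) a ht),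
        (hloc a).2.mono (prod_mono (hmono (min_le_left _ _) a) le_rfl)⟩⟩
    · obtain ⟨U, hU, hpU, hloc⟩ := h' p hp
      exact ⟨U, hU, hpU, fun a => ⟨fun t ht => (hloc a).1 t (hmono (min_le_right _ _) a ht),
        (hloc a).2.mono (prod_mono (hmono (min_le_right _ _) a) le_rfl)⟩⟩
  · intro p hp
    obtain ⟨U, hU, hpU, δ, hδ, hloc⟩ := exists_flow_nhds H p
    exact ⟨U, mem_nhdsWithin_of_mem_nhds (hU.mem_nhds hpU), δ, hδ, fun q hq => ⟨U, hU, hq, hloc⟩⟩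

lemma exists_uniform_flow_nhds_along (hp : p ∈ flowDomain α X Z s t) : ∃ δ > 0, ∀ r ∈ Icc s t,
    ∃ U : Set M, IsOpen U ∧ flow α X Z s r p ∈ U ∧ ∀ a : ℝ,
    (∀ t ∈ Icc a (a + δ), U ⊆ flowDomain α X Z a t ∧
      ContMDiffOn (𝓡 n) (𝓡 n) ∞ (flow α X Z a t) U) ∧
    ContinuousOn (fun q : ℝ × M => flow α X Z a q.1 q.2) (Icc a (a + δ) ×ˢ U) := by
  obtain ⟨δ, hδ, h⟩ := exists_uniform_flow_nhds H
    (isCompact_Icc.image_of_continuousOn (isPathSolution_flow H hp).1)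
  exact ⟨δ, hδ, fun r hr => h _ (mem_image_of_mem _ hr)⟩

/-- The domain of the flow is open and the flow is smooth: along the compact trajectory of `p`, the
flow is a composition of finitely many local flows. -/
theorem flowDomain_mem_nhds_and_contMDiffAt (hp : p ∈ flowDomain α X Z s t) :
    flowDomain α X Z s t ∈ 𝓝 p ∧ ContMDiffAt (𝓡 n) (𝓡 n) ∞ (flow α X Z s t) p := by
  obtain ⟨δ, hδ, hloc⟩ := exists_uniform_flow_nhds_along H hp
  have key : ∀ k : ℕ, ∀ r ∈ Icc s t, r ≤ s + k * δ →
      flowDomain α X Z s r ∈ 𝓝 p ∧ ContMDiffAt (𝓡 n) (𝓡 n) ∞ (flow α X Z s r) p := by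
    intro k
    induction k with
    | zero =>
      intro r hr hrs
      obtain rfl : r = s := le_antisymm (by simpa using hrs) hr.1
      refine ⟨univ_mem' fun q => mem_flowDomain_self q r, ?_⟩
      have : flow α X Z r r = id := funext fun q => flow_self H r q
      rw [this]
      exact contMDiffAt_id
    | succ k ih =>
      intro r hr hrk
      push_cast at hrk
      have hr's : s ≤ max s (r - δ) := le_max_left _ _
      have hr'r : max s (r - δ) ≤ r := max_le hr.1 (by linarith)
      have hr'δ : r ≤ max s (r - δ) + δ := by linarith [le_max_right s (r - δ)]
      have hkδ : 0 ≤ k * δ := by positivity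
      have hr'k : max s (r - δ) ≤ s + k * δ := max_le (by linarith) (by linarith)
      generalize max s (r - δ) = r' at hr's hr'r hr'δ hr'k
      obtain ⟨hnhds, hsm⟩ := ih r' ⟨hr's, hr'r.trans hr.2⟩ hr'k
      obtain ⟨U, hU, hpU, hUloc⟩ := hloc r' ⟨hr's, hr'r.trans hr.2⟩
      obtain ⟨hUD, hUsm⟩ := (hUloc r').1 r ⟨hr'r, hr'δ⟩
      have hev : ∀ᶠ q in 𝓝 p, q ∈ flowDomain α X Z s r ∧
          flow α X Z s r q = flow α X Z r' r (flow α X Z s r' q) := by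
        filter_upwards [hnhds, hsm.continuousAt.preimage_mem_nhds (hU.mem_nhds hpU)] with q h1 h2
        have hq := (flow_cocycle H hr'r h1).1.2 (hUD h2)
        exact ⟨hq, (flow_cocycle H hr'r h1).2 hq⟩
      refine ⟨hev.mono fun q hq => hq.1, ?_⟩
      have hcomp : ContMDiffAt (𝓡 n) (𝓡 n) ∞ (flow α X Z r' r ∘ flow α X Z s r') p :=
        (hUsm.contMDiffAt (hU.mem_nhds hpU)).comp p hsm
      exact hcomp.congr_of_eventuallyEq (hev.mono fun q hq => hq.2)
  obtain ⟨k, hk⟩ := exists_nat_ge ((t - s) / δ)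
  rw [div_le_iff₀ hδ] at hk
  exact key k t ⟨hp.1, le_rfl⟩ (by linarith)

/-- Openness of the domain and continuity of the flow jointly in the time and in the point. -/
theorem flow_joint (hp : p ∈ flowDomain α X Z s t) :
    (∀ᶠ q : ℝ × M in 𝓝 (t, p), s ≤ q.1 → q.2 ∈ flowDomain α X Z s q.1) ∧
      ContinuousWithinAt (fun q : ℝ × M => flow α X Z s q.1 q.2) {q | s ≤ q.1} (t, p) := by
  obtain ⟨δ, hδ, hloc⟩ := exists_uniform_flow_nhds_along H hp
  -- a time `r` before `t` but not before `s`, from which the local flow reaches beyond `t`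
  obtain ⟨r, hsr, hrt, htr, hrq⟩ : ∃ r, s ≤ r ∧ r ≤ t ∧ t < r + δ ∧
      ∀ᶠ t' in 𝓝 t, s ≤ t' → r ≤ t' := by
    rcases hp.1.eq_or_lt with hst | hst
    · exact ⟨s, le_rfl, hp.1, by linarith, Eventually.of_forall fun _ h => h⟩
    · refine ⟨max s (t - δ / 2), le_max_left _ _, max_le hp.1 (by linarith), ?_, ?_⟩
      · linarith [le_max_right s (t - δ / 2)]
      · filter_upwards [lt_mem_nhds (show max s (t - δ / 2) < t from
          max_lt hst (by linarith))] with t' ht' _ using ht'.le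
  obtain ⟨U, hU, hpU, hUloc⟩ := hloc r ⟨hsr, hrt⟩
  obtain ⟨hnhds, hsm⟩ := flowDomain_mem_nhds_and_contMDiffAt H (mem_flowDomain_of_le hp hsr hrt)
  have hD : ∀ᶠ q in 𝓝 p, q ∈ flowDomain α X Z s r := hnhds
  have hU' : ∀ᶠ q in 𝓝 p, flow α X Z s r q ∈ U :=
    hsm.continuousAt.preimage_mem_nhds (hU.mem_nhds hpU)
  have hev : ∀ᶠ q : ℝ × M in 𝓝 (t, p), s ≤ q.1 → (q.1 ∈ Icc r (r + δ) ∧ flow α X Z s r q.2 ∈ U) ∧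
      q.2 ∈ flowDomain α X Z s q.1 ∧
      flow α X Z s q.1 q.2 = flow α X Z r q.1 (flow α X Z s r q.2) := by
    rw [nhds_prod_eq]
    filter_upwards [hrq.prod_inl (𝓝 p), (gt_mem_nhds htr).prod_inl (𝓝 p), hD.prod_inr (𝓝 t),
      hU'.prod_inr (𝓝 t)] with q h1 h2 h3 h4 h5
    have hI : q.1 ∈ Icc r (r + δ) := ⟨h1 h5, h2.le⟩
    have hq := (flow_cocycle H (h1 h5) h3).1.2 (((hUloc r).1 q.1 hI).1 h4)
    exact ⟨⟨hI, h4⟩, hq, (flow_cocycle H (h1 h5) h3).2 hq⟩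
  refine ⟨hev.mono fun q hq h => (hq h).2.1, ?_⟩
  have hev' : ∀ᶠ q : ℝ × M in 𝓝[{q | s ≤ q.1}] (t, p),
      (q.1 ∈ Icc r (r + δ) ∧ flow α X Z s r q.2 ∈ U) ∧
      flow α X Z s q.1 q.2 = flow α X Z r q.1 (flow α X Z s r q.2) := by
    filter_upwards [mem_nhdsWithin_of_mem_nhds hev, self_mem_nhdsWithin] with q h1 h2
    exact ⟨(h1 h2).1, (h1 h2).2.2⟩
  have hlim : Tendsto (fun q : ℝ × M => (q.1, flow α X Z s r q.2)) (𝓝[{q | s ≤ q.1}] (t, p))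
      (𝓝[Icc r (r + δ) ×ˢ U] (t, flow α X Z s r p)) := by
    refine tendsto_nhdsWithin_iff.2 ⟨?_, hev'.mono fun q hq => hq.1⟩
    refine Tendsto.mono_left ?_ nhdsWithin_le_nhds
    exact (continuous_fst.tendsto _).prodMk_nhds
      (hsm.continuousAt.tendsto.comp (continuous_snd.tendsto (t, p)))
  have hc := ((hUloc r).2 (t, flow α X Z s r p) ⟨⟨hrt, htr.le⟩, hpU⟩).tendsto.comp hlim
  have heq : flow α X Z s t p = flow α X Z r t (flow α X Z s r p) :=
    (flow_cocycle H hrt (mem_flowDomain_of_le hp hsr hrt)).2 hp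
  rw [ContinuousWithinAt]
  rw [heq]
  exact hc.congr' (hev'.mono fun q hq => hq.2.symm)

/-! ### The inverse of the flow -/

/-- The flow of the time-reversed equation inverts the flow. -/
lemma flow_neg_flow (hp : p ∈ flowDomain α X Z s t) :
    flow α X Z s t p ∈ flowDomain α X (fun t => Z (-t)) (-t) (-s) ∧
      flow α X (fun t => Z (-t)) (-t) (-s) (flow α X Z s t p) = p := by
  have h := (isPathSolution_flow H hp).comp_neg H.smooth H.pos H.nonneg H.holder
  have hst : -t ≤ -s := neg_le_neg hp.1
  have h0 : flow α X Z s (- -t) p = flow α X Z s t p := by rw [neg_neg]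
  refine ⟨⟨hst, _, h0, h⟩, ?_⟩
  rw [flow_eq H.neg hst h h0, neg_neg, flow_self H]

theorem isDiffeoOntoOpen_flow (s t : ℝ) :
    IsDiffeoOntoOpen n (flow α X Z s t) (flowDomain α X Z s t) := by
  have hZ : (fun t => (fun t => Z (-t)) (-t)) = Z := funext fun t => by simp
  have hback : ∀ {q : M}, q ∈ flowDomain α X (fun t => Z (-t)) (-t) (-s) →
      flow α X (fun t => Z (-t)) (-t) (-s) q ∈ flowDomain α X Z s t ∧
        flow α X Z s t (flow α X (fun t => Z (-t)) (-t) (-s) q) = q := by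
    intro q hq
    have := flow_neg_flow H.neg hq
    rwa [hZ, neg_neg, neg_neg] at this
  have hopen : ∀ {Z : ℝ → EuclideanSpace ℝ (Fin d)}, IsYoungSystem α CZ X Z → ∀ s t,
      IsOpen (flowDomain α X Z s t) := fun H s t => isOpen_iff_mem_nhds.2 fun p hp =>
    (flowDomain_mem_nhds_and_contMDiffAt H hp).1
  have hsmooth : ∀ {Z : ℝ → EuclideanSpace ℝ (Fin d)}, IsYoungSystem α CZ X Z → ∀ s t,
      ContMDiffOn (𝓡 n) (𝓡 n) ∞ (flow α X Z s t) (flowDomain α X Z s t) := fun H s t p hp =>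
    (flowDomain_mem_nhds_and_contMDiffAt H hp).2.contMDiffWithinAt
  exact ⟨{ toFun := flow α X Z s t
           invFun := flow α X (fun t => Z (-t)) (-t) (-s)
           source := flowDomain α X Z s t
           target := flowDomain α X (fun t => Z (-t)) (-t) (-s)
           map_source' := fun p hp => (flow_neg_flow H hp).1
           map_target' := fun q hq => (hback hq).1
           left_inv' := fun p hp => (flow_neg_flow H hp).2
           right_inv' := fun q hq => (hback hq).2
           open_source := hopen H s t
           open_target := hopen H.neg (-t) (-s)
           continuousOn_toFun := (hsmooth H s t).continuousOn
           continuousOn_invFun := (hsmooth H.neg (-t) (-s)).continuousOn },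
    rfl, fun _ _ => rfl, hsmooth H s t, hsmooth H.neg (-t) (-s)⟩

end Flow

/-! ### Solutions in the sense of Young and local solutions -/

section Conversion

lemma norm_sub_le_of_holderOnWith {E : Type*} [NormedAddCommGroup E] {C α : ℝ≥0} {S : Set ℝ}
    {G : ℝ → E} (h : HolderOnWith C α G S) {s t : ℝ} (hs : s ∈ S) (ht : t ∈ S) (hst : s ≤ t) :
    ‖G t - G s‖ ≤ C * (t - s) ^ (α : ℝ) := by
  have := h t ht s hs
  rw [edist_dist, edist_dist, ENNReal.ofReal_rpow_of_nonneg dist_nonneg α.coe_nonneg,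
    ← ENNReal.ofReal_coe_nnreal, ← ENNReal.ofReal_mul C.coe_nonneg, ENNReal.ofReal_le_ofReal_iff
      (mul_nonneg C.coe_nonneg (Real.rpow_nonneg dist_nonneg _)), dist_eq_norm, Real.dist_eq,
      abs_of_nonneg (sub_nonneg.2 hst)] at this
  exact this

lemma holderOnWith_of_norm_sub_le {E : Type*} [NormedAddCommGroup E] {C : ℝ} {α : ℝ≥0} {a b : ℝ}
    {G : ℝ → E} (hC : 0 ≤ C)
    (h : ∀ s t, a ≤ s → s ≤ t → t ≤ b → ‖G t - G s‖ ≤ C * (t - s) ^ (α : ℝ)) :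
    HolderOnWith C.toNNReal α G (Icc a b) := by
  intro t ht s hs
  rw [edist_dist, edist_dist, ENNReal.ofReal_rpow_of_nonneg dist_nonneg α.coe_nonneg]
  change _ ≤ ENNReal.ofReal C * _
  rw [← ENNReal.ofReal_mul hC]
  refine ENNReal.ofReal_le_ofReal ?_
  rw [dist_eq_norm, Real.dist_eq]
  rcases le_total s t with hst | hst
  · rw [abs_of_nonneg (sub_nonneg.2 hst)]
    exact h s t hs.1 hst ht.2
  · rw [norm_sub_rev, abs_sub_comm, abs_of_nonneg (sub_nonneg.2 hst)]
    exact h t s ht.1 hst hs.2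

variable {n d : ℕ} {M : Type*} [TopologicalSpace M] [ChartedSpace (EuclideanSpace ℝ (Fin n)) M]
  [IsManifold (𝓡 n) ∞ M]
  {X : ∀ p : M, EuclideanSpace ℝ (Fin d) →L[ℝ] TangentSpace (𝓡 n) p}
  {α C : ℝ≥0} {T s t : ℝ} {Z : ℝ → EuclideanSpace ℝ (Fin d)} {x : ℝ → M} {p : M} {J : Set ℝ}

lemma IsPathSolution.hasYoungIntegral (hX : SmoothFields X) (hα : 1 / 2 < α)
    (hZ : HolderOnWith C α Z (Icc s t)) (h : IsPathSolution α X Z s t x)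
    {CZ : ℝ} {Z' : ℝ → EuclideanSpace ℝ (Fin d)}
    (hZ' : ∀ s t, ‖Z' t - Z' s‖ ≤ CZ * |t - s| ^ (α : ℝ))
    (hZZ' : EqOn Z' Z (Icc s t)) {f : M → ℝ} (hf : ContMDiff (𝓡 n) 𝓘(ℝ, ℝ) ∞ f) :
    HasYoungIntegral α (fun r => fieldDeriv X f (x r)) Z s t (f (x t) - f (x s)) := by
  have hα' : (1 : ℝ) / 2 < α := by exact_mod_cast hα
  have hα0 : (0 : ℝ) < α := by linarith
  have h' : IsPathSolution α X Z' s t x :=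
    ⟨h.1, fun f hf => (h.2 f hf).congr (fun _ _ => rfl) hZZ' fun _ _ => rfl⟩
  obtain ⟨CG, hCG, HG⟩ := h'.fieldDeriv_norm_sub_le hX hα0 hZ' hf
  obtain ⟨K, hK, HK⟩ := h.2 f hf
  refine ⟨⟨C, hZ⟩, ⟨α, CG.toNNReal, ?_, holderOnWith_of_norm_sub_le hCG HG⟩, ?_⟩
  · have : (1 : ℝ) < α + α := by linarith
    exact_mod_cast this
  · exact hasRSIntegral_of_germ (α := α) (β := α) (θ := 2 * α) (C := K) (CG := CG) (CZ := C)
      (I := fun r => f (x r)) hα0.le hα0.le (by linarith) (by linarith) hK hCG C.2 HG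
      (fun u v h1 h2 h3 => norm_sub_le_of_holderOnWith hZ ⟨h1, h2.trans h3⟩ ⟨h1.trans h2, h3⟩ h2) HK

/-- A solution satisfies the local form of the equation. The given Hölder exponent of the integrand
first shows that every smooth function is `α`-Hölder along the solution; the components of the
integrand are such functions, so that the exponent can be improved to `α`. -/
lemma IsSolution.isPathSolution (hX : SmoothFields X) (hα : 1 / 2 < α)
    (hZ : HolderOnWith C α Z (Icc s t)) (h : IsSolution T α X Z s p J x) (ht : t ∈ J) :
    IsPathSolution α X Z s t x := by
  have hα' : (1 : ℝ) / 2 < α := by exact_mod_cast hα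
  have hα0 : (0 : ℝ) ≤ α := α.2
  have hst : s ≤ t := (h.subset_Icc ht).1
  have hsub : Icc s t ⊆ J := h.ordConnected.out h.start_mem ht
  have hc : ContinuousOn x (Icc s t) := h.continuousOn.mono hsub
  have hZ' : ∀ u v, s ≤ u → u ≤ v → v ≤ t → ‖Z v - Z u‖ ≤ C * (v - u) ^ (α : ℝ) :=
    fun u v h1 h2 h3 => norm_sub_le_of_holderOnWith hZ ⟨h1, h2.trans h3⟩ ⟨h1.trans h2, h3⟩ h2
  have hRS : ∀ {f : M → ℝ}, ContMDiff (𝓡 n) 𝓘(ℝ, ℝ) ∞ f → ∀ r ∈ Icc s t,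
      HasRSIntegral (fun r => fieldDeriv X f (x r)) Z s r (f (x r) - f (x s)) :=
    fun hf r hr => (h.equation _ hf r (hsub hr)).2.2
  have hf_holder : ∀ {f : M → ℝ}, ContMDiff (𝓡 n) 𝓘(ℝ, ℝ) ∞ f → ∃ K, 0 ≤ K ∧
      ∀ u v, s ≤ u → u ≤ v → v ≤ t → ‖f (x v) - f (x u)‖ ≤ K * (v - u) ^ (α : ℝ) := by
    intro f hf
    obtain ⟨β, CG, hβ, hG⟩ := (h.equation f hf t ht).2.1
    have hβ' : (1 : ℝ) < α + β := by exact_mod_cast hβ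
    obtain ⟨K, hK, HK⟩ := exists_germ_bound_of_hasRSIntegral (I := fun r => f (x r)) hα0 β.2 hβ'
      CG.2 C.2 hst (fun u v h1 h2 h3 => norm_sub_le_of_holderOnWith hG ⟨h1, h2.trans h3⟩ ⟨h1.trans h2, h3⟩ h2) hZ'
      (hRS hf)
    obtain ⟨B, hB⟩ := isCompact_Icc.exists_bound_of_continuousOn
      ((IsPathSolution.continuous_fieldDeriv hX hf).comp_continuousOn hc)
    exact norm_sub_le_of_germ (J := fun r => f (x r)) hα0 β.2 (le_max_right B 0) hK
      (fun t ht => (hB t ht).trans (le_max_left _ _)) hZ' HK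
  refine ⟨hc, fun f hf => ?_⟩
  choose K hK HK using fun i => hf_holder
    (contMDiff_vectorFieldDeriv_apply hX hf (EuclideanSpace.basisFun (Fin d) ℝ i))
  have hG : ∀ u v, s ≤ u → u ≤ v → v ≤ t →
      ‖fieldDeriv X f (x v) - fieldDeriv X f (x u)‖ ≤ (∑ i, K i) * (v - u) ^ (α : ℝ) := by
    intro u v h1 h2 h3
    refine (opNorm_le_sum_basis _).trans ?_
    rw [Finset.sum_mul]
    exact Finset.sum_le_sum fun i _ => HK i u v h1 h2 h3
  obtain ⟨L, hL, HL⟩ := exists_germ_bound_of_hasRSIntegral (I := fun r => f (x r)) hα0 hα0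
    (by linarith) (Finset.sum_nonneg fun i _ => hK i) C.2 hst hG hZ' (hRS hf)
  refine ⟨L, hL, fun u v h1 h2 h3 => ?_⟩
  rw [two_mul]
  exact HL u v h1 h2 h3

/-! ### Maximal solutions and the local flow -/

/-- The driver, extended to the line by constants. -/
noncomputable def extendDriver (T : ℝ) (Z : ℝ → EuclideanSpace ℝ (Fin d)) (t : ℝ) :
    EuclideanSpace ℝ (Fin d) := Z (max 0 (min T t))

lemma eqOn_extendDriver (hs : 0 ≤ s) (ht : t ≤ T) : EqOn (extendDriver T Z) Z (Icc s t) := by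
  intro r hr
  unfold extendDriver
  rw [min_eq_right (hr.2.trans ht), max_eq_right (hs.trans hr.1)]

lemma isYoungSystem_extendDriver (hT : 0 < T) (hα : 1 / 2 < α) (hX : SmoothFields X)
    (hZ : HolderOnWith C α Z (Icc 0 T)) : IsYoungSystem (α : ℝ) C X (extendDriver T Z) :=
  ⟨hX, by exact_mod_cast hα, C.2, norm_clamp_sub_le hT.le C.2 α.2 fun _ _ h1 h2 h3 =>
    norm_sub_le_of_holderOnWith hZ ⟨h1, h2.trans h3⟩ ⟨h1.trans h2, h3⟩ h2⟩

/-- The set of the points whose solution started at time `s` exists up to the time `t ≤ T`. -/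
def domain (T : ℝ) (α : ℝ≥0) (X : ∀ p : M, EuclideanSpace ℝ (Fin d) →L[ℝ] TangentSpace (𝓡 n) p)
    (Z : ℝ → EuclideanSpace ℝ (Fin d)) (s t : ℝ) : Set M :=
  {p | t ≤ T ∧ p ∈ flowDomain α X (extendDriver T Z) s t}

variable [T2Space M] (hT : 0 < T) (hα : 1 / 2 < α) (hX : SmoothFields X)
    (hZ : HolderOnWith C α Z (Icc 0 T))
include hT hα hX hZ

/-- Every solution is a restriction of a trajectory of the flow. -/
lemma IsSolution.subset_and_eqOn (hs : 0 ≤ s) (h : IsSolution T α X Z s p J x) :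
    J ⊆ {t | p ∈ domain T α X Z s t} ∧
      EqOn x (fun t => flow α X (extendDriver T Z) s t p) J := by
  have hsol : ∀ t ∈ J, IsPathSolution α X (extendDriver T Z) s t x := by
    intro t ht
    have htT := (h.subset_Icc ht).2
    have h1 := h.isPathSolution hX hα (hZ.mono (Icc_subset_Icc hs htT)) ht
    exact ⟨h1.1, fun f hf => (h1.2 f hf).congr (fun _ _ => rfl) (eqOn_extendDriver hs htT)
      fun _ _ => rfl⟩
  refine ⟨fun t ht => ⟨(h.subset_Icc ht).2, (h.subset_Icc ht).1, x, h.initial, hsol t ht⟩,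
    fun t ht => ?_⟩
  exact (flow_eq (isYoungSystem_extendDriver hT hα hX hZ) (h.subset_Icc ht).1 (hsol t ht)
    h.initial).symm

lemma continuousOn_flow (s : ℝ) :
    ContinuousOn (fun q : ℝ × M => flow α X (extendDriver T Z) s q.1 q.2)
      {q : ℝ × M | q.2 ∈ domain T α X Z s q.1} := fun _ hq =>
  (flow_joint (isYoungSystem_extendDriver hT hα hX hZ) hq.2).2.mono fun _ hq' => hq'.2.1

lemma isMaximalSolution_flow (hs : s ∈ Icc 0 T) (p : M) :
    IsMaximalSolution T α X Z s p {t | p ∈ domain T α X Z s t}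
      (fun t => flow α X (extendDriver T Z) s t p) := by
  have H := isYoungSystem_extendDriver hT hα hX hZ
  refine ⟨⟨⟨fun t ht u hu r hr => ?_⟩, ⟨hs.2, mem_flowDomain_self p s⟩, fun t ht => ⟨ht.2.1, ht.1⟩,
    ?_, flow_self H s p, fun f hf t ht => ?_⟩, fun J' x' h' hJ _ => ?_⟩
  · exact ⟨hr.2.trans hu.1, mem_flowDomain_of_le hu.2 (ht.2.1.trans hr.1) hr.2⟩
  · exact (continuousOn_flow hT hα hX hZ s).comp (f := fun t : ℝ => (t, p)) (by fun_prop)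
      fun t ht => ht
  · have heq := eqOn_extendDriver (Z := Z) hs.1 ht.1
    have hsol := isPathSolution_flow H ht.2
    exact IsPathSolution.hasYoungIntegral hX hα (hZ.mono (Icc_subset_Icc hs.1 ht.1))
      ⟨hsol.1, fun f hf => (hsol.2 f hf).congr (fun _ _ => rfl) heq.symm fun _ _ => rfl⟩
      H.holder heq hf
  · exact Subset.antisymm (h'.subset_and_eqOn hT hα hX hZ hs.1).1 hJ

theorem isLocalFlow_flow :
    IsLocalFlow T α X Z (domain T α X Z) (flow α X (extendDriver T Z)) := by
  have H := isYoungSystem_extendDriver hT hα hX hZ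
  refine ⟨fun s hs p => isMaximalSolution_flow hT hα hX hZ hs p, fun s _ => ?_,
    fun s _ => continuousOn_flow hT hα hX hZ s, fun s t _ _ htT => ?_,
    fun s t u _ hst htu huT p hp => ?_⟩
  · refine ⟨interior {q : ℝ × M | s ≤ q.1 → q.2 ∈ flowDomain α X (extendDriver T Z) s q.1},
      isOpen_interior, Subset.antisymm (fun q hq => ⟨?_, ⟨hq.2.1, hq.1⟩, trivial⟩) ?_⟩
    · exact mem_interior_iff_mem_nhds.2 (flow_joint H hq.2).1
    · exact fun q hq => ⟨hq.2.1.2, interior_subset hq.1 hq.2.1.1⟩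
  · have : domain T α X Z s t = flowDomain α X (extendDriver T Z) s t :=
      Set.ext fun p => ⟨fun h => h.2, fun h => ⟨htT, h⟩⟩
    rw [this]
    exact isDiffeoOntoOpen_flow H s t
  · obtain ⟨h1, h2⟩ := flow_cocycle H htu hp.2
    exact ⟨⟨fun h => ⟨huT, h1.1 h.2⟩, fun h => ⟨huT, h1.2 h.2⟩⟩, fun h => h2 h.2⟩

/-- The interval of existence is closed only if it is the whole interval. -/
lemma interval_eq (p : M) : {t | p ∈ domain T α X Z 0 t} = Icc 0 T ∨
    ∃ τ ∈ Ioc 0 T, {t | p ∈ domain T α X Z 0 t} = Ico 0 τ := by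
  have H := isYoungSystem_extendDriver hT hα hX hZ
  set J := {t | p ∈ domain T α X Z 0 t} with hJ
  have hdown : ∀ {t u}, u ∈ J → 0 ≤ t → t ≤ u → t ∈ J := fun hu h0 h1 =>
    ⟨h1.trans hu.1, mem_flowDomain_of_le hu.2 h0 h1⟩
  have hJT : ∀ t ∈ J, t ∈ Icc 0 T := fun t ht => ⟨ht.2.1, ht.1⟩
  have h0J : (0 : ℝ) ∈ J := ⟨hT.le, mem_flowDomain_self p 0⟩
  by_cases hTJ : T ∈ J
  · exact Or.inl (Subset.antisymm hJT fun t ht => hdown hTJ ht.1 ht.2)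
  right
  have hbdd : BddAbove J := ⟨T, fun t ht => ht.1⟩
  have hτ : sSup J ∉ J := by
    intro hmem
    have hlt : sSup J < T := lt_of_le_of_ne hmem.1 fun h => hTJ (by rwa [h] at hmem)
    have h1 : ∀ᶠ t in 𝓝 (sSup J), (0 : ℝ) ≤ t → p ∈ flowDomain α X (extendDriver T Z) 0 t :=
      (Continuous.prodMk_left p).continuousAt.eventually (flow_joint H hmem.2).1
    have h2 : ∀ᶠ t in 𝓝[>] (sSup J), t ∈ Ioc (sSup J) T := Ioc_mem_nhdsGT hlt
    obtain ⟨t, ht1, ht2⟩ := ((h1.filter_mono nhdsWithin_le_nhds).and h2).exists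
    have : t ∈ J := ⟨ht2.2, ht1 (hmem.2.1.trans ht2.1.le)⟩
    exact absurd (le_csSup hbdd this) (not_le.2 ht2.1)
  have h0 : 0 < sSup J := lt_of_le_of_ne (le_csSup hbdd h0J) fun h => hτ (by rwa [← h])
  refine ⟨sSup J, ⟨h0, csSup_le ⟨0, h0J⟩ fun t ht => ht.1⟩, Subset.antisymm (fun t ht => ?_) ?_⟩
  · exact ⟨ht.2.1, lt_of_le_of_ne (le_csSup hbdd ht) fun h => hτ (by rwa [← h])⟩
  · intro t ht
    obtain ⟨u, hu, htu⟩ := exists_lt_of_lt_csSup ⟨0, h0J⟩ ht.2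
    exact hdown hu ht.1 htu.le

end Conversion

end Young

theorem mainTheorem3 {n d : ℕ} {M : Type*} [TopologicalSpace M] [T2Space M] [ParacompactSpace M]
    [ChartedSpace (EuclideanSpace ℝ (Fin n)) M] [IsManifold (𝓡 n) ∞ M]
    (T : ℝ) (hT : 0 < T) (α : ℝ≥0) (hα : 1 / 2 < α) (hα' : α ≤ 1)
    (X : ∀ p : M, EuclideanSpace ℝ (Fin d) →L[ℝ] TangentSpace (𝓡 n) p)
    (hX : Young.SmoothFields X)
    (Z : ℝ → EuclideanSpace ℝ (Fin d)) (hZ : ∃ C : ℝ≥0, HolderOnWith C α Z (Icc 0 T)) :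
    (∀ x₀ : M, ∃ (J : Set ℝ) (x : ℝ → M),
      Young.IsMaximalSolution T α X Z 0 x₀ J x ∧
      (J = Icc 0 T ∨ ∃ τ ∈ Ioc 0 T, J = Ico 0 τ) ∧
      (∀ (J' : Set ℝ) (y : ℝ → M), Young.IsMaximalSolution T α X Z 0 x₀ J' y →
        J' = J ∧ EqOn y x J) ∧
      (∀ (J' : Set ℝ) (y : ℝ → M), Young.IsSolution T α X Z 0 x₀ J' y →
        J' ⊆ J ∧ EqOn y x J')) ∧
    ∃ (D : ℝ → ℝ → Set M) (φ : ℝ → ℝ → M → M), Young.IsLocalFlow T α X Z D φ := by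
  obtain ⟨C, hZ⟩ := hZ
  refine ⟨fun x₀ => ?_, _, _, Young.isLocalFlow_flow hT hα hX hZ⟩
  have hmax := Young.isMaximalSolution_flow hT hα hX hZ (left_mem_Icc.2 hT.le) x₀
  have hsub : ∀ (J' : Set ℝ) (y : ℝ → M), Young.IsSolution T α X Z 0 x₀ J' y → _ := fun J' y hy =>
    hy.subset_and_eqOn hT hα hX hZ le_rfl
  refine ⟨_, _, hmax, Young.interval_eq hT hα hX hZ x₀, fun J' y hy => ?_, hsub⟩
  obtain ⟨h1, h2⟩ := hsub J' y hy.isSolution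
  have hJ := hy.maximal _ _ hmax.isSolution h1 h2
  exact ⟨hJ.symm, hJ ▸ h2⟩
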